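/- Let $\nu$ be the law of a nonnegative demand $D$ with distribution function $F_D$, and assume that $\bar D=\sup\{x: F_D(x)<1\}$ is finite. Let $d_1,d_2,\dots$ be i.i.d. samples of $D$. Let $c(x,d)$ be the cost of ordering $x\ge 0$ when the demand is $d\ge 0$; assume that $c(\cdot,d)$ is convex on $[0,\infty)$ for every $d\ge 0$, that $C(x)=\mathbb E[c(x,D)]$ exists for every $x\ge 0$, and that $C$ is twice differentiable on $[0,\infty)$ (one-sidedly at $0$). Let $c'(\cdot,d)$ be a subgradient function of $c(\cdot,d)$ on $[0,\infty)$, and put $$\hat C_t(x)=\frac1t\sum_{i=1}^t c(x,d_i),\qquad \hat g_t(x)=\frac1t\sum_{i=1}^t c'(x,d_i).$$ Let $T\ge 1$. For $1\le t\le T$ let the sample average approximation (SAA) decision $\hat x_t$ be a random variable with $\hat x_t\in\arg\min_{x\ge 0}\hat C_t(x)$ almost surely, where, if the minimizer is not unique, a minimizer larger than $\bar D$ is chosen only if all minimizers are larger than $\bar D$. Let $x^*=\arg\min_{x\ge 0}C(x)$ be the unique minimizer of $C$. Assume that there are constants $B,C_1\ge 0$ such that 1. for every $d\ge 0$, $c(\cdot,d)$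 is minimized over $[0,\infty)$ by some $x_d\le d$; 2. $|c'(x,d)|\le B$ for all $x,d\ge 0$; 3. $|\hat g_t(\hat x_t)|\le C_1/\sqrt t$ almost surely, for every $1\le t\le T$. Assume further that $C$ is $(\alpha,\beta)$-locally strongly convex, that is, $\alpha,\beta>0$ and $C''(x)\ge\alpha$ for all $x\in[x^*-\beta,x^*+\beta]\cap[0,\bar D]$. Then $C(\hat x_t)-C(x^*)$ is integrable for every $1\le t\le T$, and $$\sum_{t=1}^T\mathbb E\big[C(\hat x_t)-C(x^*)\big]\le K_1+K_2\cdot\frac1{\alpha\beta}+K_3\cdot\frac{\ln T}{\alpha},$$ where, for a universal constant $C_0>0$ (independent of all the data above), $$K_4=(4C_0B+C_1)^2+2B^2+\sqrt{2\pi}\,B\,(4C_0B+C_1),\qquad K_1=2\bar D\sqrt{K_4},\qquad K_3=2K_4,$$ $$K_2=8\sqrt2\,\bar D\sqrt{K_4}\,(4C_0B+C_1)+\frac{8\bar D\sqrt{K_4}}{4C_0B+C_1}.$$ -/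

import Mathlib

open MeasureTheory ProbabilityTheory Set

noncomputable section

namespace Newsvendor

/-- The expected cost `C(x) = E[c(x, D)]` of the order quantity `x`, for demand `D` with law `ν`. -/
def expectedCost (c : ℝ → ℝ → ℝ) (ν : Measure ℝ) (x : ℝ) : ℝ :=
  ∫ d, c x d ∂ν

/-- The derivative `g = C'` on the domain `[0, ∞)` of order quantities (one-sided at `0`). -/
def costDeriv (c : ℝ → ℝ → ℝ) (ν : Measure ℝ) (x : ℝ) : ℝ :=
  derivWithin (expectedCost c ν) (Ici 0) x

/-- The second derivative `C''` on `[0, ∞)` (one-sided at `0`). -/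
def costDeriv₂ (c : ℝ → ℝ → ℝ) (ν : Measure ℝ) (x : ℝ) : ℝ :=
  derivWithin (costDeriv c ν) (Ici 0) x

/-- `C` is twice differentiable on `[0, ∞)`. -/
def TwiceDifferentiableCost (c : ℝ → ℝ → ℝ) (ν : Measure ℝ) : Prop :=
  DifferentiableOn ℝ (expectedCost c ν) (Ici 0) ∧ DifferentiableOn ℝ (costDeriv c ν) (Ici 0)

/-- `{x | F_D(x) < 1}` for demand with law `ν`. -/
def demandSet (ν : Measure ℝ) : Set ℝ := {x | cdf ν x < 1}

/-- The largest possible demand `D̄ = sup {x | F_D(x) < 1}`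
(meaningful when `demandSet ν` is bounded above). -/
def demandBound (ν : Measure ℝ) : ℝ := sSup (demandSet ν)

/-- `x` is the (unique) minimizer over `[0, ∞)` of the expected cost. -/
def IsOptimalOrder (c : ℝ → ℝ → ℝ) (ν : Measure ℝ) (x : ℝ) : Prop :=
  0 ≤ x ∧ ∀ y, 0 ≤ y → y ≠ x → expectedCost c ν x < expectedCost c ν y

/-- `(α, β)`-local strong convexity of the expected cost around `xstar`. -/
def LocallyStronglyConvex (c : ℝ → ℝ → ℝ) (ν : Measure ℝ) (xstar α β : ℝ) : Prop :=
  0 < α ∧ 0 < β ∧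
    ∀ x ∈ Icc (xstar - β) (xstar + β) ∩ Icc 0 (demandBound ν), α ≤ costDeriv₂ c ν x

/-- `c' x d` is a subgradient at `x` of the function `c(·, d)` on `[0, ∞)`, for all `x, d ≥ 0`. -/
def IsSubgradientFunction (c c' : ℝ → ℝ → ℝ) : Prop :=
  ∀ d, 0 ≤ d → ∀ x, 0 ≤ x → ∀ y, 0 ≤ y → c x d + c' x d * (y - x) ≤ c y d

/-- The sample average cost `Ĉ_t(x)` of the first `t` demands `d 0, …, d (t - 1)`. -/
def empiricalCost (c : ℝ → ℝ → ℝ) (t : ℕ) (d : ℕ → ℝ) (x : ℝ) : ℝ :=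
  (1 / (t : ℝ)) * ∑ i ∈ Finset.range t, c x (d i)

/-- The sample average subgradient `ĝ_t(x)` of the first `t` demands. -/
def empiricalGradient (c' : ℝ → ℝ → ℝ) (t : ℕ) (d : ℕ → ℝ) (x : ℝ) : ℝ :=
  (1 / (t : ℝ)) * ∑ i ∈ Finset.range t, c' x (d i)

/-- `x` minimizes the sample average cost over `[0, ∞)`. -/
def IsEmpiricalMinimizer (c : ℝ → ℝ → ℝ) (t : ℕ) (d : ℕ → ℝ) (x : ℝ) : Prop :=
  0 ≤ x ∧ ∀ y, 0 ≤ y → empiricalCost c t d x ≤ empiricalCost c t d y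

/-- `x` is a sample average approximation order: it minimizes the sample average cost over
`[0, ∞)`, and a minimizer exceeding the bound `M` on the demand is only chosen if all minimizers
exceed `M`. The second clause holds automatically if the minimizer is unique. -/
def IsSAAOrder (c : ℝ → ℝ → ℝ) (M : ℝ) (t : ℕ) (d : ℕ → ℝ) (x : ℝ) : Prop :=
  IsEmpiricalMinimizer c t d x ∧ (M < x → ∀ y, IsEmpiricalMinimizer c t d y → M < y)

/-- `K₄ = (4 C₀ B + C₁)² + 2 B² + √(2π) B (4 C₀ B + C₁)`. -/
def K₄ (C₀ B C₁ : ℝ) : ℝ :=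
  (4 * C₀ * B + C₁) ^ 2 + 2 * B ^ 2 + √(2 * Real.pi) * B * (4 * C₀ * B + C₁)

/-- `K₁ = 2 D̄ √K₄`. -/
def K₁ (C₀ B C₁ Dbar : ℝ) : ℝ := 2 * Dbar * √(K₄ C₀ B C₁)

/-- `K₂ = 8 √2 D̄ √K₄ (4 C₀ B + C₁) + 8 D̄ √K₄ / (4 C₀ B + C₁)`. -/
def K₂ (C₀ B C₁ Dbar : ℝ) : ℝ :=
  8 * √2 * Dbar * √(K₄ C₀ B C₁) * (4 * C₀ * B + C₁)
    + 8 * Dbar * √(K₄ C₀ B C₁) / (4 * C₀ * B + C₁)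

/-- `K₃ = 2 K₄`. -/
def K₃ (C₀ B C₁ : ℝ) : ℝ := 2 * K₄ C₀ B C₁

end Newsvendor

end

set_option linter.unusedSectionVars false

/-! Write g = C'. The regret is controlled by g at the SAA order, and the empirical subgradient
there is at most C₁/√t. So it suffices to bound the deviation of ĝ_t from g uniformly on [0, D̄] by
Y/√t with E Y⁴ ≤ (100B)⁴ (`exists_uniform_gradient_error`). Then |g(x̂_t)| ≤ W = (C₁ + Y)/√t, except
that at x̂_t = 0 only -g ≤ W is available, which is all that is needed there.

The uniform bound comes from chaining. Any subgradient is squeezed between right derivatives of c,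
which are monotone in x and bounded by B. Hence the L¹ distance of two right derivatives is exactly
the increment of g. After reparametrising [0, D̄] so that g is affine in s ∈ [0, 1], an increment
over δ has L¹ norm at most 2Bδ. Fourth moments of centred sums, added over dyadic grids, control the
maximum on a grid of mesh about 1/√t (`exists_chaining_bound`); monotonicity brackets all points in
between.

Convexity gives regret ≤ g(x̂_t)(x̂_t - x*) ≤ D̄W, and local strong convexity improves this to W²/α
unless W ≥ αβ (`regret_le_of_costDeriv_le`). With A = C₁ + 100B, the expected regret is at most
A²/(αt) plus a tail term, which the fourth moment makes summable in t with total of order D̄A²/(αβ).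
The terms 1/t with t ≥ 2 sum to at most ln T, and the first period costs at most D̄A. As A² ≤ K₄,
the stated constants dominate (`bound_le_K`). -/

namespace Newsvendor

open Filter Topology

/-! ### Moments of sums of independent variables -/

section Moments

variable {Ω : Type*} [MeasurableSpace Ω] {P : Measure Ω} [IsProbabilityMeasure P]

/-- An almost everywhere bounded, almost everywhere measurable function is integrable. -/
lemma integrable_of_abs_le {X : Ω → ℝ} {M : ℝ} (hX : AEMeasurable X P)
    (hb : ∀ᵐ ω ∂P, |X ω| ≤ M) : Integrable X P :=
  (integrable_const M).mono' hX.aestronglyMeasurable hb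

lemma integrable_pow_mul_pow {X Y : Ω → ℝ} {M N : ℝ} (hX : AEMeasurable X P)
    (hY : AEMeasurable Y P) (hXb : ∀ᵐ ω ∂P, |X ω| ≤ M) (hYb : ∀ᵐ ω ∂P, |Y ω| ≤ N) (a b : ℕ) :
    Integrable (fun ω => X ω ^ a * Y ω ^ b) P := by
  refine integrable_of_abs_le (M := M ^ a * N ^ b) ((hX.pow_const a).mul (hY.pow_const b)) ?_
  filter_upwards [hXb, hYb] with ω h1 h2
  rw [abs_mul, abs_pow, abs_pow]
  gcongr
  exact pow_nonneg ((abs_nonneg _).trans h1) _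

lemma integral_pow_mul_pow {X Y : Ω → ℝ} (h : IndepFun X Y P) (hX : AEMeasurable X P)
    (hY : AEMeasurable Y P) (a b : ℕ) :
    ∫ ω, X ω ^ a * Y ω ^ b ∂P = (∫ ω, X ω ^ a ∂P) * ∫ ω, Y ω ^ b ∂P :=
  h.integral_fun_comp_mul_comp (f := fun x => x ^ a) (g := fun x => x ^ b) hX hY
    (by fun_prop) (by fun_prop)

/-- Second and fourth moments of a sum of independent centred bounded variables. -/
lemma integral_sum_pow_le {X : ℕ → Ω → ℝ} {M V : ℝ} (hm : ∀ i, AEMeasurable (X i) P)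
    (hind : iIndepFun X P) (hb : ∀ i, ∀ᵐ ω ∂P, |X i ω| ≤ M) (h0 : ∀ i, ∫ ω, X i ω ∂P = 0)
    (hV : ∀ i, ∫ ω, X i ω ^ 2 ∂P ≤ V) (n : ℕ) :
    ∫ ω, (∑ i ∈ Finset.range n, X i ω) ^ 2 ∂P ≤ n * V ∧
    ∫ ω, (∑ i ∈ Finset.range n, X i ω) ^ 4 ∂P ≤ 3 * n ^ 2 * V ^ 2 + n * M ^ 2 * V := by
  have hV0 : 0 ≤ V := (integral_nonneg fun ω => sq_nonneg _).trans (hV 0)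
  induction n with
  | zero => simp
  | succ n ih =>
    obtain ⟨ih2, ih4⟩ := ih
    set S : Ω → ℝ := fun ω => ∑ i ∈ Finset.range n, X i ω with hS
    have hSm : AEMeasurable S P := Finset.aemeasurable_fun_sum _ fun i _ => hm i
    have hSb : ∀ᵐ ω ∂P, |S ω| ≤ n * M := by
      filter_upwards [ae_all_iff.2 hb] with ω hω
      refine (Finset.abs_sum_le_sum_abs _ _).trans ?_
      refine (Finset.sum_le_sum fun i _ => hω i).trans ?_
      simp
    have hSX : IndepFun S (X n) P := by
      have := hind.indepFun_sum_range_succ₀ hm n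
      have h : (∑ j ∈ Finset.range n, X j) = S := by
        ext ω; simp [hS]
      rwa [h] at this
    have hI : ∀ a b, Integrable (fun ω => S ω ^ a * X n ω ^ b) P :=
      integrable_pow_mul_pow hSm (hm n) hSb (hb n)
    have hE := integral_pow_mul_pow hSX hSm (hm n)
    have hX4 : ∫ ω, X n ω ^ 4 ∂P ≤ M ^ 2 * V := by
      calc ∫ ω, X n ω ^ 4 ∂P ≤ ∫ ω, M ^ 2 * X n ω ^ 2 ∂P := by
            refine integral_mono_ae (by simpa using hI 0 4)
              (Integrable.const_mul (by simpa using hI 0 2) _) ?_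
            filter_upwards [hb n] with ω hω
            have : X n ω ^ 2 ≤ M ^ 2 := sq_le_sq' (abs_le.1 hω).1 (abs_le.1 hω).2
            nlinarith [sq_nonneg (X n ω)]
        _ ≤ M ^ 2 * V := by
            rw [integral_const_mul]
            exact mul_le_mul_of_nonneg_left (hV n) (sq_nonneg _)
    -- In the expansion of (S + X)², (S + X)⁴, every cross term containing a first power of S or X
    -- has mean zero; only 6 E[S²] E[X²] survives.
    have e10 := hE 1 1
    have e31 := hE 3 1
    have e22 := hE 2 2
    have e13 := hE 1 3
    have hS1 : ∫ ω, S ω ∂P = 0 := by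
      rw [hS, integral_finsetSum]
      · simp [h0]
      · intro i _
        exact integrable_of_abs_le (hm i) (hb i)
    simp only [pow_one, h0, hS1, mul_zero, zero_mul] at e10 e31 e13
    have i10 := hI 1 1
    have i31 := hI 3 1
    have i22 := hI 2 2
    have i13 := hI 1 3
    have i20 := hI 2 0
    have i40 := hI 4 0
    have i02 := hI 0 2
    have i04 := hI 0 4
    simp only [pow_one, pow_zero, mul_one, one_mul] at i10 i31 i22 i13 i20 i40 i02 i04
    constructor
    · have h1 : ∫ ω, (∑ i ∈ Finset.range (n + 1), X i ω) ^ 2 ∂P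
          = ∫ ω, (S ω ^ 2 + 2 * (S ω * X n ω) + X n ω ^ 2) ∂P := by
        refine integral_congr_ae (ae_of_all _ fun ω => ?_)
        simp only [Finset.sum_range_succ, hS]
        ring
      rw [h1, integral_add (i20.fun_add (i10.const_mul 2)) i02, integral_add i20 (i10.const_mul 2),
        integral_const_mul, e10]
      push_cast
      linarith [hV n]
    · have h1 : ∫ ω, (∑ i ∈ Finset.range (n + 1), X i ω) ^ 4 ∂P
          = ∫ ω, (S ω ^ 4 + 4 * (S ω ^ 3 * X n ω) + 6 * (S ω ^ 2 * X n ω ^ 2)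
            + 4 * (S ω * X n ω ^ 3) + X n ω ^ 4) ∂P := by
        refine integral_congr_ae (ae_of_all _ fun ω => ?_)
        simp only [Finset.sum_range_succ, hS]
        ring
      rw [h1, integral_add (((i40.fun_add (i31.const_mul 4)).fun_add (i22.const_mul 6)).fun_add
          (i13.const_mul 4)) i04,
        integral_add ((i40.fun_add (i31.const_mul 4)).fun_add (i22.const_mul 6)) (i13.const_mul 4),
        integral_add (i40.fun_add (i31.const_mul 4)) (i22.const_mul 6),
        integral_add i40 (i31.const_mul 4), integral_const_mul, integral_const_mul,
        integral_const_mul, e31, e13, e22]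
      -- The surviving cross term is at most 6nV², and 3n² + 6n ≤ 3(n + 1)².
      have h2 : (∫ ω, S ω ^ 2 ∂P) * ∫ ω, X n ω ^ 2 ∂P ≤ n * V * V :=
        mul_le_mul ih2 (hV n) (integral_nonneg fun ω => sq_nonneg _) (by positivity)
      push_cast
      nlinarith [sq_nonneg V]

end Moments

/-! ### Centred sums of functions of the demands -/

section Centred

variable {Ω : Type*} [MeasurableSpace Ω] {P : Measure Ω} [IsProbabilityMeasure P]
  {ν : Measure ℝ} [IsProbabilityMeasure ν] {D : ℕ → Ω → ℝ}

/-- The centred sum `∑ (h(Dᵢ) - E h(D))` of the first `n` demands. -/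
noncomputable def centredSum (ν : Measure ℝ) (D : ℕ → Ω → ℝ) (n : ℕ) (h : ℝ → ℝ) (ω : Ω) : ℝ :=
  ∑ i ∈ Finset.range n, (h (D i ω) - ∫ d, h d ∂ν)

lemma centredSum_sub {h k : ℝ → ℝ} (hh : Integrable h ν) (hk : Integrable k ν) (n : ℕ) (ω : Ω) :
    centredSum ν D n (fun d => h d - k d) ω
      = centredSum ν D n h ω - centredSum ν D n k ω := by
  simp only [centredSum, integral_sub hh hk, ← Finset.sum_sub_distrib]
  exact Finset.sum_congr rfl fun i _ => by ring

lemma HasLaw.ae_comp {X : Ω → ℝ} (hX : HasLaw X ν P) {p : ℝ → Prop} (hp : ∀ᵐ d ∂ν, p d) :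
    ∀ᵐ ω ∂P, p (X ω) := by
  have h := hX.map_eq
  rw [← h] at hp
  exact ae_of_ae_map hX.aemeasurable hp

lemma aemeasurable_centredSum (hD : ∀ i, HasLaw (D i) ν P) {h : ℝ → ℝ} (hm : AEMeasurable h ν)
    (n : ℕ) : AEMeasurable (centredSum ν D n h) P := by
  refine Finset.aemeasurable_fun_sum _ fun i _ => ?_
  have : AEMeasurable h (P.map (D i)) := by rwa [(hD i).map_eq]
  exact (this.comp_aemeasurable (hD i).aemeasurable).sub_const _

lemma abs_integral_le_of_abs_le {h : ℝ → ℝ} {M : ℝ} (hb : ∀ᵐ d ∂ν, |h d| ≤ M) :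
    |∫ d, h d ∂ν| ≤ M := by
  have := norm_integral_le_of_norm_le_const (μ := ν) (f := h) hb
  simpa using this

lemma integrable_centredSum_pow (hD : ∀ i, HasLaw (D i) ν P) {h : ℝ → ℝ} {M : ℝ}
    (hm : AEMeasurable h ν) (hb : ∀ᵐ d ∂ν, |h d| ≤ M) (n k : ℕ) :
    Integrable (fun ω => centredSum ν D n h ω ^ k) P := by
  refine integrable_of_abs_le (M := (n * (2 * M)) ^ k)
    ((aemeasurable_centredSum hD hm n).pow_const k) ?_
  filter_upwards [ae_all_iff.2 fun i => HasLaw.ae_comp (hD i) hb] with ω hω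
  rw [abs_pow]
  gcongr
  refine (Finset.abs_sum_le_sum_abs _ _).trans ?_
  refine (Finset.sum_le_sum (g := fun _ => 2 * M) fun i _ => ?_).trans (by simp)
  refine (abs_sub _ _).trans ?_
  linarith [hω i, abs_integral_le_of_abs_le hb]

/-- Fourth moment bound for the centred sum of a bounded function of the demands. -/
lemma integral_centredSum_pow_four_le (hD : ∀ i, HasLaw (D i) ν P) (hind : iIndepFun D P)
    {h : ℝ → ℝ} {M V : ℝ} (hm : AEMeasurable h ν) (hb : ∀ᵐ d ∂ν, |h d| ≤ M)
    (hV : ∫ d, h d ^ 2 ∂ν ≤ V) (n : ℕ) :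
    ∫ ω, centredSum ν D n h ω ^ 4 ∂P ≤ 3 * n ^ 2 * V ^ 2 + n * (2 * M) ^ 2 * V := by
  have hint : Integrable h ν := integrable_of_abs_le hm hb
  have hint2 : Integrable (fun d => h d ^ 2) ν := by
    simpa using integrable_pow_mul_pow hm hm hb hb 2 0
  set f : ℝ → ℝ := fun d => h d - ∫ d, h d ∂ν with hf
  have hfm : AEMeasurable f ν := hm.sub_const _
  refine (integral_sum_pow_le (X := fun i => f ∘ D i) (M := 2 * M) (V := V) ?_ ?_ ?_ ?_ ?_ n).2
  · intro i
    have : AEMeasurable f (P.map (D i)) := by rwa [(hD i).map_eq]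
    exact this.comp_aemeasurable (hD i).aemeasurable
  · exact hind.comp₀ (fun _ => f) (fun i => (hD i).aemeasurable)
      (fun i => by rwa [(hD i).map_eq])
  · intro i
    refine HasLaw.ae_comp (p := fun d => |f d| ≤ 2 * M) (hD i) ?_
    filter_upwards [hb] with d hd
    refine (abs_sub _ _).trans ?_
    linarith [abs_integral_le_of_abs_le hb]
  · intro i
    rw [(hD i).integral_comp hfm.aestronglyMeasurable, hf, integral_sub hint (integrable_const _)]
    simp
  · intro i
    have h1 : ∫ ω, (f ∘ D i) ω ^ 2 ∂P = ∫ d, f d ^ 2 ∂ν :=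
      (hD i).integral_comp (f := fun d => f d ^ 2) (hfm.pow_const 2).aestronglyMeasurable
    rw [h1]
    refine le_trans ?_ hV
    set m := ∫ d, h d ∂ν with hmdef
    have h2 : ∫ d, f d ^ 2 ∂ν = ∫ d, (h d ^ 2 - 2 * m * h d + m ^ 2) ∂ν :=
      integral_congr_ae (ae_of_all _ fun d => by simp only [hf]; ring)
    have i1 : Integrable (fun d => h d ^ 2 - 2 * m * h d) ν := hint2.sub (hint.const_mul _)
    rw [h2, integral_add i1 (integrable_const _),
      integral_sub hint2 (hint.const_mul _), integral_const_mul, ← hmdef]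
    simp
    nlinarith [sq_nonneg m]

end Centred

/-- Convexity of the fourth power: a + b is s + w times the weighted mean of a/s and b/w. In the
chaining, s and w are the weights given to successive levels. -/
lemma add_pow_four_le {a b s w A Q : ℝ} (hs : 0 < s) (hw : 0 < w) (ha : a ^ 4 ≤ s ^ 3 * A)
    (hb : b ^ 4 ≤ w ^ 3 * Q) : (a + b) ^ 4 ≤ (s + w) ^ 3 * (A + Q) := by
  have key : ∀ x y : ℝ, (s * x + w * y) ^ 2 ≤ (s + w) * (s * x ^ 2 + w * y ^ 2) := fun x y => by
    nlinarith [mul_nonneg (mul_nonneg hs.le hw.le) (sq_nonneg (x - y))]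
  set x := a / s
  set y := b / w
  have hx : a = s * x := by simp only [x]; field_simp
  have hy : b = w * y := by simp only [y]; field_simp
  have hA : s * x ^ 4 ≤ A := by
    rw [hx] at ha
    have : s ^ 3 * (s * x ^ 4) ≤ s ^ 3 * A := by linarith [show (s * x) ^ 4 = s ^ 3 * (s * x ^ 4) by ring]
    exact le_of_mul_le_mul_left this (by positivity)
  have hQ : w * y ^ 4 ≤ Q := by
    rw [hy] at hb
    have : w ^ 3 * (w * y ^ 4) ≤ w ^ 3 * Q := by linarith [show (w * y) ^ 4 = w ^ 3 * (w * y ^ 4) by ring]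
    exact le_of_mul_le_mul_left this (by positivity)
  have h2 := key (x ^ 2) (y ^ 2)
  rw [hx, hy]
  calc (s * x + w * y) ^ 4 = ((s * x + w * y) ^ 2) ^ 2 := by ring
    _ ≤ ((s + w) * (s * x ^ 2 + w * y ^ 2)) ^ 2 := pow_le_pow_left₀ (sq_nonneg _) (key x y) 2
    _ = (s + w) ^ 2 * (s * x ^ 2 + w * y ^ 2) ^ 2 := by ring
    _ ≤ (s + w) ^ 2 * ((s + w) * (s * (x ^ 2) ^ 2 + w * (y ^ 2) ^ 2)) := by gcongr
    _ = (s + w) ^ 3 * (s * x ^ 4 + w * y ^ 4) := by ring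
    _ ≤ (s + w) ^ 3 * (A + Q) := by gcongr

lemma dyadic_mem_Icc {j k : ℕ} (hj : j ≤ 2 ^ k) : (j : ℝ) / 2 ^ k ∈ Icc (0 : ℝ) 1 := by
  refine ⟨by positivity, ?_⟩
  rw [div_le_one (by positivity)]
  exact_mod_cast hj

/-- The grid point j of level k + 1 has as parent the point ⌊j/2⌋ of level k. -/
lemma abs_dyadic_sub_le (j k : ℕ) :
    |(j : ℝ) / 2 ^ (k + 1) - ((j / 2 : ℕ) : ℝ) / 2 ^ k| ≤ 1 / 2 ^ (k + 1) := by
  have h : (j : ℝ) = 2 * ((j / 2 : ℕ) : ℝ) + ((j % 2 : ℕ) : ℝ) := by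
    exact_mod_cast (Nat.div_add_mod j 2).symm
  have h1 : ((j % 2 : ℕ) : ℝ) ≤ 1 := by
    exact_mod_cast Nat.lt_succ_iff.1 (Nat.mod_lt j two_pos)
  have h2 : (j : ℝ) / 2 ^ (k + 1) - ((j / 2 : ℕ) : ℝ) / 2 ^ k
      = ((j % 2 : ℕ) : ℝ) / 2 ^ (k + 1) := by
    rw [h, pow_succ]
    field_simp
    ring
  rw [h2, abs_of_nonneg (by positivity)]
  gcongr

/-! ### Chaining over dyadic grids -/

section Chaining

variable {Ω : Type*} [MeasurableSpace Ω] {P : Measure Ω} [IsProbabilityMeasure P]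
  {ν : Measure ℝ} [IsProbabilityMeasure ν] {D : ℕ → Ω → ℝ}

/-- Fourth moment of an increment of a process whose increments are small in `L¹`. -/
lemma integral_centredSum_sub_pow_four_le (hD : ∀ i, HasLaw (D i) ν P) (hind : iIndepFun D P)
    {h k : ℝ → ℝ} {B δ : ℝ} (hh : AEMeasurable h ν) (hk : AEMeasurable k ν)
    (hhb : ∀ᵐ d ∂ν, |h d| ≤ B) (hkb : ∀ᵐ d ∂ν, |k d| ≤ B) (hB : 0 ≤ B)
    (hδ : ∫ d, |h d - k d| ∂ν ≤ 2 * B * δ) (n : ℕ) :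
    Integrable (fun ω => (centredSum ν D n h ω - centredSum ν D n k ω) ^ 4) P ∧
    ∫ ω, (centredSum ν D n h ω - centredSum ν D n k ω) ^ 4 ∂P
      ≤ 48 * n ^ 2 * B ^ 4 * δ ^ 2 + 64 * n * B ^ 4 * δ := by
  have hfm : AEMeasurable (fun d => h d - k d) ν := hh.sub hk
  have hfb : ∀ᵐ d ∂ν, |h d - k d| ≤ 2 * B := by
    filter_upwards [hhb, hkb] with d h1 h2
    exact (abs_sub _ _).trans (by linarith)
  have heq := fun ω => centredSum_sub (D := D) (integrable_of_abs_le hh hhb)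
    (integrable_of_abs_le hk hkb) n ω
  simp only [← heq]
  refine ⟨integrable_centredSum_pow hD hfm hfb n 4, ?_⟩
  -- One of the two factors is bounded by 2B, so the second moment is linear in δ.
  have hV : ∫ d, (h d - k d) ^ 2 ∂ν ≤ 4 * B ^ 2 * δ := by
    calc ∫ d, (h d - k d) ^ 2 ∂ν ≤ ∫ d, 2 * B * |h d - k d| ∂ν := by
          refine integral_mono_ae (by simpa using integrable_pow_mul_pow hfm hfm hfb hfb 2 0)
            ((integrable_of_abs_le hfm hfb).abs.const_mul _) ?_
          filter_upwards [hfb] with d hd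
          have := abs_nonneg (h d - k d)
          nlinarith [sq_abs (h d - k d)]
      _ ≤ 4 * B ^ 2 * δ := by
          rw [integral_const_mul]
          nlinarith
  refine (integral_centredSum_pow_four_le hD hind hfm hfb hV n).trans (le_of_eq ?_)
  ring

/-- Chaining along the dyadic grids of levels `≤ K`. -/
lemma exists_chaining_bound_aux (hD : ∀ i, HasLaw (D i) ν P) (hind : iIndepFun D P)
    {φ : ℝ → ℝ → ℝ} {B : ℝ} (hB : 0 ≤ B) (hm : ∀ s ∈ Icc (0 : ℝ) 1, AEMeasurable (φ s) ν)
    (hb : ∀ s ∈ Icc (0 : ℝ) 1, ∀ᵐ d ∂ν, |φ s d| ≤ B)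
    (hL : ∀ s ∈ Icc (0 : ℝ) 1, ∀ s' ∈ Icc (0 : ℝ) 1,
      ∫ d, |φ s d - φ s' d| ∂ν ≤ 2 * B * |s - s'|)
    {n K : ℕ} (hn : 4 ^ K ≤ n) {k : ℕ} (hk : k ≤ K) :
    ∃ Q : Ω → ℝ, Integrable Q P ∧ (∀ ω, 0 ≤ Q ω) ∧
      ∫ ω, Q ω ∂P ≤ n ^ 2 * B ^ 4 * (504 - 490 * (500 / 729) ^ k) ∧
      ∀ ω, ∀ j : ℕ, j ≤ 2 ^ k → centredSum ν D n (φ (j / 2 ^ k)) ω ^ 4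
        ≤ (10 - 9 * (9 / 10) ^ k) ^ 3 * Q ω := by
  -- Level i has weight (9/10)^i, and 10 - 9(9/10)^k is the sum of the weights up to level k. In
  -- units of n²B⁴, level 0 costs 14 = 7 + 7 and level i ≥ 1 costs 224 rⁱ, where r = 500/729 =
  -- (10/9)³/2. The budget 504 - 490 r^k absorbs this since 490(1 - r) ≥ 224 r.
  have hn1 : (1 : ℝ) ≤ n := by exact_mod_cast (Nat.one_le_pow _ _ (by norm_num)).trans hn
  induction k with
  | zero =>
    have h0 : (0 : ℝ) ∈ Icc (0 : ℝ) 1 := by simp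
    have h1 : (1 : ℝ) ∈ Icc (0 : ℝ) 1 := by simp
    have hI : ∀ s ∈ Icc (0 : ℝ) 1, Integrable (fun ω => centredSum ν D n (φ s) ω ^ 4) P :=
      fun s hs => integrable_centredSum_pow hD (hm s hs) (hb s hs) n 4
    have hE : ∀ s ∈ Icc (0 : ℝ) 1,
        ∫ ω, centredSum ν D n (φ s) ω ^ 4 ∂P ≤ 7 * (n ^ 2 * B ^ 4) := by
      intro s hs
      have hV : ∫ d, φ s d ^ 2 ∂ν ≤ B ^ 2 := by
        have := integral_mono_ae (μ := ν)
          (by simpa using integrable_pow_mul_pow (hm s hs) (hm s hs) (hb s hs) (hb s hs) 2 0)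
          (integrable_const (B ^ 2)) (f := fun d => φ s d ^ 2) (by
            filter_upwards [hb s hs] with d hd
            exact sq_le_sq' (abs_le.1 hd).1 (abs_le.1 hd).2)
        simpa using this
      refine (integral_centredSum_pow_four_le hD hind (hm s hs) (hb s hs) hV n).trans ?_
      have : (n : ℝ) * B ^ 4 ≤ n ^ 2 * B ^ 4 := by
        gcongr
        nlinarith
      nlinarith
    refine ⟨fun ω => centredSum ν D n (φ 0) ω ^ 4 + centredSum ν D n (φ 1) ω ^ 4,
      (hI 0 h0).add (hI 1 h1), fun ω => by positivity, ?_, ?_⟩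
    · rw [integral_add (hI 0 h0) (hI 1 h1)]
      linarith [hE 0 h0, hE 1 h1]
    · intro ω j hj
      have e0 : 0 ≤ centredSum ν D n (φ 0) ω ^ 4 := by positivity
      have e1 : 0 ≤ centredSum ν D n (φ 1) ω ^ 4 := by positivity
      have hj' : j = 0 ∨ j = 1 := by
        rw [pow_zero] at hj
        omega
      norm_num
      rcases hj' with rfl | rfl
      · simpa using e1
      · simpa using e0
  | succ k ih =>
    obtain ⟨Q, hQi, hQ0, hQE, hQb⟩ := ih (Nat.le_of_succ_le hk)
    set w : ℝ := (9 / 10) ^ (k + 1) with hw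
    have hw0 : 0 < w := by positivity
    set p : ℝ := 2 ^ (k + 1) with hp
    have hp1 : 1 ≤ p := one_le_pow₀ (by norm_num)
    have hpn : p ^ 2 ≤ n := by
      have : (4 : ℕ) ^ (k + 1) ≤ n := (Nat.pow_le_pow_right (by norm_num) hk).trans hn
      have h' : ((4 : ℕ) ^ (k + 1) : ℝ) ≤ n := by exact_mod_cast this
      refine le_trans (le_of_eq ?_) h'
      rw [hp, ← pow_mul, mul_comm, pow_mul]
      norm_num
    set T : ℕ → Ω → ℝ := fun j ω => (centredSum ν D n (φ (j / 2 ^ (k + 1))) ω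
      - centredSum ν D n (φ ((j / 2 : ℕ) / 2 ^ k)) ω) ^ 4 with hT
    have hhalf : ∀ j, j ≤ 2 ^ (k + 1) → j / 2 ≤ 2 ^ k := fun j hj => by
      rw [pow_succ] at hj
      omega
    have hTE : ∀ j ∈ Finset.range (2 ^ (k + 1) + 1), Integrable (T j) P ∧
        ∫ ω, T j ω ∂P ≤ 48 * n ^ 2 * B ^ 4 * (1 / p) ^ 2 + 64 * n * B ^ 4 * (1 / p) := by
      intro j hj
      have hj := Nat.lt_succ_iff.1 (Finset.mem_range.1 hj)
      have m1 := dyadic_mem_Icc hj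
      have m2 := dyadic_mem_Icc (hhalf j hj)
      refine integral_centredSum_sub_pow_four_le hD hind (hm _ m1) (hm _ m2) (hb _ m1) (hb _ m2)
        hB ((hL _ m1 _ m2).trans ?_) n
      gcongr
      exact abs_dyadic_sub_le j k
    have hTs : Integrable (fun ω => ∑ j ∈ Finset.range (2 ^ (k + 1) + 1), T j ω) P :=
      integrable_finsetSum _ fun j hj => (hTE j hj).1
    -- There are p + 1 ≤ 2p links from points to their parents. The part of the fourth moment linear
    -- in 1/p is harmless because p ≤ n, a consequence of p² ≤ n.
    have hTS : ∫ ω, ∑ j ∈ Finset.range (2 ^ (k + 1) + 1), T j ω ∂P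
        ≤ 224 * (n ^ 2 * B ^ 4) / p := by
      rw [integral_finsetSum _ fun j hj => (hTE j hj).1]
      refine (Finset.sum_le_sum fun j hj => (hTE j hj).2).trans ?_
      rw [Finset.sum_const, Finset.card_range, nsmul_eq_mul]
      push_cast
      rw [← hp]
      have h1 : (p + 1) * (48 * n ^ 2 * B ^ 4 * (1 / p) ^ 2 + 64 * n * B ^ 4 * (1 / p))
          ≤ (2 * p) * (48 * n ^ 2 * B ^ 4 * (1 / p) ^ 2 + 64 * n * B ^ 4 * (1 / p)) := by
        gcongr
        linarith
      refine h1.trans ?_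
      rw [le_div_iff₀ (by positivity)]
      have h2 : (2 * p) * (48 * n ^ 2 * B ^ 4 * (1 / p) ^ 2 + 64 * n * B ^ 4 * (1 / p)) * p
          = 96 * n ^ 2 * B ^ 4 + 128 * (n * p) * B ^ 4 := by
        field_simp
        ring
      rw [h2]
      have h3 : (n : ℝ) * p ≤ n ^ 2 := by
        rw [sq]
        gcongr
        nlinarith
      have : (n : ℝ) * p * B ^ 4 ≤ n ^ 2 * B ^ 4 := by gcongr
      nlinarith
    -- The maximum over the links is replaced by their sum, so that one variable serves all grid
    -- points.
    refine ⟨fun ω => Q ω + (w ^ 3)⁻¹ * ∑ j ∈ Finset.range (2 ^ (k + 1) + 1), T j ω,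
      hQi.add (hTs.const_mul _), fun ω => ?_, ?_, ?_⟩
    · have : ∀ j, 0 ≤ T j ω := fun j => by simp only [hT]; positivity
      have := Finset.sum_nonneg (s := Finset.range (2 ^ (k + 1) + 1)) fun j _ => this j
      have := hQ0 ω
      positivity
    · rw [integral_add hQi (hTs.const_mul _), integral_const_mul]
      have h1 : (w ^ 3)⁻¹ * ∫ ω, ∑ j ∈ Finset.range (2 ^ (k + 1) + 1), T j ω ∂P
          ≤ (w ^ 3)⁻¹ * (224 * (n ^ 2 * B ^ 4) / p) := by gcongr
      have h2 : (w ^ 3)⁻¹ * (224 * (n ^ 2 * B ^ 4) / p)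
          = n ^ 2 * B ^ 4 * (224 * (500 / 729) ^ (k + 1)) := by
        have : (w ^ 3)⁻¹ * p⁻¹ = (500 / 729) ^ (k + 1) := by
          rw [hw, hp, ← mul_inv, ← pow_mul, mul_comm (k + 1) 3, pow_mul, ← mul_pow, ← inv_pow]
          norm_num
        rw [← this]
        ring
      have h3 : (0 : ℝ) ≤ (500 / 729) ^ k := by positivity
      have h4 : (0 : ℝ) ≤ n ^ 2 * B ^ 4 := by positivity
      have h5 : (504 - 490 * (500 / 729) ^ k) + 224 * (500 / 729) ^ (k + 1)
          ≤ (504 - 490 * (500 / 729 : ℝ) ^ (k + 1)) := by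
        rw [pow_succ]
        linarith
      have := mul_le_mul_of_nonneg_left h5 h4
      linarith
    · intro ω j hj
      have ha := hQb ω (j / 2) (hhalf j hj)
      have hsk : (0 : ℝ) < 10 - 9 * (9 / 10) ^ k := by
        have : (9 / 10 : ℝ) ^ k ≤ 1 := pow_le_one₀ (by norm_num) (by norm_num)
        linarith
      have hbj : (centredSum ν D n (φ (j / 2 ^ (k + 1))) ω
          - centredSum ν D n (φ ((j / 2 : ℕ) / 2 ^ k)) ω) ^ 4
          ≤ w ^ 3 * ((w ^ 3)⁻¹ * ∑ j ∈ Finset.range (2 ^ (k + 1) + 1), T j ω) := by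
        rw [mul_inv_cancel_left₀ (by positivity)]
        exact Finset.single_le_sum (f := fun j => T j ω)
          (fun i _ => by simp only [hT]; positivity) (Finset.mem_range.2 (Nat.lt_succ_of_le hj))
      have := add_pow_four_le hsk hw0 ha hbj
      rw [add_sub_cancel] at this
      refine this.trans (le_of_eq ?_)
      congr 2
      rw [hw, pow_succ]
      ring

/-- Maximal inequality in `L⁴` over a dyadic grid. -/
lemma exists_chaining_bound (hD : ∀ i, HasLaw (D i) ν P) (hind : iIndepFun D P)
    {φ : ℝ → ℝ → ℝ} {B : ℝ} (hB : 0 ≤ B) (hm : ∀ s ∈ Icc (0 : ℝ) 1, AEMeasurable (φ s) ν)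
    (hb : ∀ s ∈ Icc (0 : ℝ) 1, ∀ᵐ d ∂ν, |φ s d| ≤ B)
    (hL : ∀ s ∈ Icc (0 : ℝ) 1, ∀ s' ∈ Icc (0 : ℝ) 1,
      ∫ d, |φ s d - φ s' d| ∂ν ≤ 2 * B * |s - s'|)
    {n K : ℕ} (hn : 4 ^ K ≤ n) :
    ∃ Q : Ω → ℝ, Integrable Q P ∧ (∀ ω, 0 ≤ Q ω) ∧
      ∫ ω, Q ω ∂P ≤ 10 ^ 6 * (n ^ 2 * B ^ 4) ∧
      ∀ ω, ∀ j : ℕ, j ≤ 2 ^ K → centredSum ν D n (φ (j / 2 ^ K)) ω ^ 4 ≤ Q ω := by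
  obtain ⟨Q, hQi, hQ0, hQE, hQb⟩ := exists_chaining_bound_aux hD hind hB hm hb hL hn le_rfl
  refine ⟨fun ω => 10 ^ 3 * Q ω, hQi.const_mul _, fun ω => by have := hQ0 ω; positivity, ?_, ?_⟩
  · rw [integral_const_mul]
    have h3 : (0 : ℝ) ≤ (500 / 729) ^ K := by positivity
    have h4 : (0 : ℝ) ≤ n ^ 2 * B ^ 4 := by positivity
    nlinarith [mul_nonneg h3 h4]
  · intro ω j hj
    refine (hQb ω j hj).trans ?_
    have h1 : (9 / 10 : ℝ) ^ K ≤ 1 := pow_le_one₀ (by norm_num) (by norm_num)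
    have h2 : (0 : ℝ) ≤ (9 / 10) ^ K := by positivity
    exact mul_le_mul_of_nonneg_right (pow_le_pow_left₀ (by linarith) (by linarith) 3) (hQ0 ω)

end Chaining

/-! ### Right derivatives of the cost and the derivative of its expectation -/

/-- The standing regularity assumptions on the cost function. -/
structure IsRegularCost (c c' : ℝ → ℝ → ℝ) (ν : Measure ℝ) (B : ℝ) : Prop where
  nonneg : ∀ᵐ d ∂ν, 0 ≤ d
  convex : ∀ d, 0 ≤ d → ConvexOn ℝ (Ici 0) (fun x => c x d)
  integrable : ∀ x, 0 ≤ x → Integrable (c x) ν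
  diff : TwiceDifferentiableCost c ν
  subgradient : IsSubgradientFunction c c'
  bound : ∀ d, 0 ≤ d → ∀ x, 0 ≤ x → |c' x d| ≤ B

/-- Difference quotients of the cost with step `1 / (n + 1)`. -/
noncomputable def costSlope (c : ℝ → ℝ → ℝ) (x d : ℝ) (n : ℕ) : ℝ :=
  ((n : ℝ) + 1) * (c (x + 1 / ((n : ℝ) + 1)) d - c x d)

/-- The right derivative of the cost in the order quantity. -/
noncomputable def costRightDeriv (c : ℝ → ℝ → ℝ) (x d : ℝ) : ℝ := ⨅ n, costSlope c x d n

namespace IsRegularCost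

variable {c c' : ℝ → ℝ → ℝ} {ν : Measure ℝ} {B : ℝ}

lemma le_costSlope (h : IsRegularCost c c' ν B) {x d : ℝ} (hd : 0 ≤ d) (hx : 0 ≤ x) (n : ℕ) :
    c' x d ≤ costSlope c x d n := by
  have hn : (0 : ℝ) < (n : ℝ) + 1 := by positivity
  have h1 := h.subgradient d hd x hx (x + 1 / ((n : ℝ) + 1)) (by positivity)
  have h2 : c' x d * (1 / ((n : ℝ) + 1)) ≤ c (x + 1 / ((n : ℝ) + 1)) d - c x d := by
    rw [add_sub_cancel_left] at h1
    linarith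
  calc c' x d = ((n : ℝ) + 1) * (c' x d * (1 / ((n : ℝ) + 1))) := by field_simp
    _ ≤ _ := mul_le_mul_of_nonneg_left h2 hn.le

lemma costSlope_le (h : IsRegularCost c c' ν B) {x d : ℝ} (hd : 0 ≤ d) (hx : 0 ≤ x) (n : ℕ) :
    costSlope c x d n ≤ c' (x + 1 / ((n : ℝ) + 1)) d := by
  have hn : (0 : ℝ) < (n : ℝ) + 1 := by positivity
  have h1 := h.subgradient d hd (x + 1 / ((n : ℝ) + 1)) (by positivity) x hx
  have h2 : c (x + 1 / ((n : ℝ) + 1)) d - c x d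
      ≤ c' (x + 1 / ((n : ℝ) + 1)) d * (1 / ((n : ℝ) + 1)) := by
    linarith
  calc costSlope c x d n
      ≤ ((n : ℝ) + 1) * (c' (x + 1 / ((n : ℝ) + 1)) d * (1 / ((n : ℝ) + 1))) :=
        mul_le_mul_of_nonneg_left h2 hn.le
    _ = _ := by field_simp

lemma subgradient_mono (h : IsRegularCost c c' ν B) {x y d : ℝ} (hd : 0 ≤ d) (hx : 0 ≤ x)
    (hxy : x ≤ y) : c' x d ≤ c' y d := by
  rcases hxy.eq_or_lt with rfl | hlt
  · rfl
  have h1 := h.subgradient d hd x hx y (hx.trans hxy)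
  have h2 := h.subgradient d hd y (hx.trans hxy) x hx
  nlinarith

lemma antitone_costSlope (h : IsRegularCost c c' ν B) {x d : ℝ} (hd : 0 ≤ d) (hx : 0 ≤ x) :
    Antitone (costSlope c x d) := by
  intro m n hmn
  have hm : (0 : ℝ) < (m : ℝ) + 1 := by positivity
  have hn : (0 : ℝ) < (n : ℝ) + 1 := by positivity
  have hmn' : (m : ℝ) ≤ n := by exact_mod_cast hmn
  have hp : 1 / ((n : ℝ) + 1) ≤ 1 / ((m : ℝ) + 1) := by gcongr
  have := (h.convex d hd).secant_mono (a := x) (x := x + 1 / ((n : ℝ) + 1))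
    (y := x + 1 / ((m : ℝ) + 1)) hx (by simp only [mem_Ici]; positivity)
    (by simp only [mem_Ici]; positivity) (by simp; positivity) (by simp; positivity) (by linarith)
  simp only [add_sub_cancel_left, one_div, div_inv_eq_mul] at this
  simp only [costSlope, one_div]
  linarith

lemma abs_costSlope_le (h : IsRegularCost c c' ν B) {x d : ℝ} (hd : 0 ≤ d) (hx : 0 ≤ x) (n : ℕ) :
    |costSlope c x d n| ≤ B := by
  have hn : (0 : ℝ) < (n : ℝ) + 1 := by positivity
  have h1 := (abs_le.1 (h.bound d hd x hx)).1
  have h2 := (abs_le.1 (h.bound d hd (x + 1 / ((n : ℝ) + 1)) (by positivity))).2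
  exact abs_le.2 ⟨h1.trans (h.le_costSlope hd hx n), (h.costSlope_le hd hx n).trans h2⟩

lemma tendsto_costSlope (h : IsRegularCost c c' ν B) {x d : ℝ} (hd : 0 ≤ d) (hx : 0 ≤ x) :
    Tendsto (costSlope c x d) atTop (𝓝 (costRightDeriv c x d)) :=
  tendsto_atTop_ciInf (h.antitone_costSlope hd hx)
    ⟨c' x d, by rintro _ ⟨n, rfl⟩; exact h.le_costSlope hd hx n⟩

lemma le_costRightDeriv (h : IsRegularCost c c' ν B) {x d : ℝ} (hd : 0 ≤ d) (hx : 0 ≤ x) :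
    c' x d ≤ costRightDeriv c x d :=
  le_ciInf fun n => h.le_costSlope hd hx n

/-- With `le_costRightDeriv`, this interlaces any choice of subgradients with the right derivatives,
so that only the latter need a probabilistic estimate. -/
lemma costRightDeriv_le (h : IsRegularCost c c' ν B) {x y d : ℝ} (hd : 0 ≤ d) (hx : 0 ≤ x)
    (hxy : x < y) : costRightDeriv c x d ≤ c' y d := by
  obtain ⟨n, hn⟩ := exists_nat_one_div_lt (sub_pos.2 hxy)
  refine (ciInf_le ⟨c' x d, by rintro _ ⟨n, rfl⟩; exact h.le_costSlope hd hx n⟩ n).trans ?_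
  refine (h.costSlope_le hd hx n).trans (h.subgradient_mono hd (by positivity) (by linarith))

lemma costRightDeriv_mono (h : IsRegularCost c c' ν B) {x y d : ℝ} (hd : 0 ≤ d) (hx : 0 ≤ x)
    (hxy : x ≤ y) : costRightDeriv c x d ≤ costRightDeriv c y d := by
  rcases hxy.eq_or_lt with rfl | hlt
  · rfl
  · exact (h.costRightDeriv_le hd hx hlt).trans (h.le_costRightDeriv hd (hx.trans hxy))

lemma abs_costRightDeriv_le (h : IsRegularCost c c' ν B) {x d : ℝ} (hd : 0 ≤ d) (hx : 0 ≤ x) :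
    |costRightDeriv c x d| ≤ B :=
  abs_le.2 ⟨(abs_le.1 (h.bound d hd x hx)).1.trans (h.le_costRightDeriv hd hx),
    (h.costRightDeriv_le hd hx (lt_add_one x)).trans
      (abs_le.1 (h.bound d hd (x + 1) (by positivity))).2⟩

lemma aestronglyMeasurable_costSlope (h : IsRegularCost c c' ν B) {x : ℝ} (hx : 0 ≤ x) (n : ℕ) :
    AEStronglyMeasurable (fun d => costSlope c x d n) ν :=
  ((h.integrable (x + 1 / ((n : ℝ) + 1)) (by positivity)).aestronglyMeasurable.sub
    (h.integrable x hx).aestronglyMeasurable).const_mul _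

/-- The subgradient `c'` is not assumed measurable in the demand; the right derivative is, as a
limit of a sequence of difference quotients. -/
lemma aemeasurable_costRightDeriv (h : IsRegularCost c c' ν B) {x : ℝ} (hx : 0 ≤ x) :
    AEMeasurable (costRightDeriv c x) ν := by
  refine (aestronglyMeasurable_of_tendsto_ae atTop
    (fun n => h.aestronglyMeasurable_costSlope hx n) ?_).aemeasurable
  filter_upwards [h.nonneg] with d hd using h.tendsto_costSlope hd hx

lemma ae_abs_costRightDeriv_le (h : IsRegularCost c c' ν B) {x : ℝ} (hx : 0 ≤ x) :
    ∀ᵐ d ∂ν, |costRightDeriv c x d| ≤ B := by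
  filter_upwards [h.nonneg] with d hd using h.abs_costRightDeriv_le hd hx

variable [IsProbabilityMeasure ν]

lemma integrable_costRightDeriv (h : IsRegularCost c c' ν B) {x : ℝ} (hx : 0 ≤ x) :
    Integrable (costRightDeriv c x) ν :=
  integrable_of_abs_le (h.aemeasurable_costRightDeriv hx) (h.ae_abs_costRightDeriv_le hx)

/-- The derivative of the expected cost is the expected right derivative. -/
lemma integral_costRightDeriv (h : IsRegularCost c c' ν B) {x : ℝ} (hx : 0 ≤ x) :
    ∫ d, costRightDeriv c x d ∂ν = costDeriv c ν x := by
  have h1 : Tendsto (fun n => ∫ d, costSlope c x d n ∂ν) atTop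
      (𝓝 (∫ d, costRightDeriv c x d ∂ν)) := by
    refine tendsto_integral_of_dominated_convergence (fun _ => B)
      (fun n => h.aestronglyMeasurable_costSlope hx n) (integrable_const B) (fun n => ?_) ?_
    · filter_upwards [h.nonneg] with d hd using h.abs_costSlope_le hd hx n
    · filter_upwards [h.nonneg] with d hd using h.tendsto_costSlope hd hx
  have h2 : HasDerivWithinAt (expectedCost c ν) (costDeriv c ν x) (Ici 0) x :=
    (h.diff.1 x hx).hasDerivWithinAt
  rw [hasDerivWithinAt_iff_tendsto_slope] at h2
  have h3 : Tendsto (fun n : ℕ => x + 1 / ((n : ℝ) + 1)) atTop (𝓝[Ici 0 \ {x}] x) := by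
    refine tendsto_nhdsWithin_iff.2 ⟨?_, Eventually.of_forall fun n => ?_⟩
    · simpa using (tendsto_one_div_add_atTop_nhds_zero_nat (𝕜 := ℝ)).const_add x
    · have : (0 : ℝ) < 1 / ((n : ℝ) + 1) := by positivity
      exact ⟨by simp only [mem_Ici]; positivity, by simp only [mem_singleton_iff]; linarith⟩
  refine tendsto_nhds_unique h1 ((h2.comp h3).congr fun n => ?_)
  have hn : (0 : ℝ) < (n : ℝ) + 1 := by positivity
  simp only [Function.comp, slope_def_field, costSlope, expectedCost]
  rw [integral_const_mul, integral_sub (h.integrable _ (by positivity)) (h.integrable x hx)]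
  rw [add_sub_cancel_left]
  field_simp

lemma costDeriv_mono (h : IsRegularCost c c' ν B) {x y : ℝ} (hx : 0 ≤ x) (hxy : x ≤ y) :
    costDeriv c ν x ≤ costDeriv c ν y := by
  rw [← h.integral_costRightDeriv hx, ← h.integral_costRightDeriv (hx.trans hxy)]
  refine integral_mono_ae (h.integrable_costRightDeriv hx)
    (h.integrable_costRightDeriv (hx.trans hxy)) ?_
  filter_upwards [h.nonneg] with d hd using h.costRightDeriv_mono hd hx hxy

lemma abs_costDeriv_le (h : IsRegularCost c c' ν B) {x : ℝ} (hx : 0 ≤ x) :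
    |costDeriv c ν x| ≤ B := by
  rw [← h.integral_costRightDeriv hx]
  exact abs_integral_le_of_abs_le (h.ae_abs_costRightDeriv_le hx)

/-- Monotonicity in the order quantity fixes the sign of the difference for almost all demands. This
is the increment estimate behind the chaining. -/
lemma integral_abs_costRightDeriv_sub (h : IsRegularCost c c' ν B) {x y : ℝ} (hx : 0 ≤ x)
    (hy : 0 ≤ y) : ∫ d, |costRightDeriv c x d - costRightDeriv c y d| ∂ν
      = |costDeriv c ν x - costDeriv c ν y| := by
  wlog hxy : y ≤ x generalizing x y
  · simp_rw [abs_sub_comm (costRightDeriv c x _), abs_sub_comm (costDeriv c ν x)]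
    exact this hy hx (le_of_not_ge hxy)
  rw [abs_of_nonneg (sub_nonneg.2 (h.costDeriv_mono hy hxy)), ← h.integral_costRightDeriv hx,
    ← h.integral_costRightDeriv hy,
    ← integral_sub (h.integrable_costRightDeriv hx) (h.integrable_costRightDeriv hy)]
  refine integral_congr_ae ?_
  filter_upwards [h.nonneg] with d hd
  exact abs_of_nonneg (sub_nonneg.2 (h.costRightDeriv_mono hd hy hxy))

lemma continuousOn_costDeriv (h : IsRegularCost c c' ν B) :
    ContinuousOn (costDeriv c ν) (Ici 0) := h.diff.2.continuousOn

lemma continuousOn_expectedCost (h : IsRegularCost c c' ν B) :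
    ContinuousOn (expectedCost c ν) (Ici 0) := h.diff.1.continuousOn

lemma convexOn_expectedCost (h : IsRegularCost c c' ν B) :
    ConvexOn ℝ (Ici 0) (expectedCost c ν) := by
  refine ⟨convex_Ici 0, fun x hx y hy a b ha hb hab => ?_⟩
  have hz : 0 ≤ a • x + b • y := convex_Ici (0 : ℝ) hx hy ha hb hab
  simp only [expectedCost, smul_eq_mul]
  rw [← integral_const_mul, ← integral_const_mul,
    ← integral_add ((h.integrable x hx).const_mul a) ((h.integrable y hy).const_mul b)]
  refine integral_mono_ae (h.integrable _ hz)
    (((h.integrable x hx).const_mul a).add ((h.integrable y hy).const_mul b)) ?_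
  filter_upwards [h.nonneg] with d hd
  exact (h.convex d hd).2 hx hy ha hb hab

lemma expectedCost_gradient_le (h : IsRegularCost c c' ν B) {x y : ℝ} (hx : 0 ≤ x) (hy : 0 ≤ y) :
    expectedCost c ν x + costDeriv c ν x * (y - x) ≤ expectedCost c ν y := by
  have hd : HasDerivWithinAt (expectedCost c ν) (costDeriv c ν x) (Ici 0) x :=
    (h.diff.1 x hx).hasDerivWithinAt
  rcases lt_trichotomy x y with hxy | rfl | hxy
  · have := h.convexOn_expectedCost.le_slope_of_hasDerivWithinAt hx hy hxy hd
    rw [slope_def_field, le_div_iff₀ (sub_pos.2 hxy)] at this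
    linarith
  · simp
  · have := h.convexOn_expectedCost.slope_le_of_hasDerivWithinAt hy hx hxy hd
    rw [slope_def_field, div_le_iff₀ (sub_pos.2 hxy)] at this
    linarith

/-- A curve in `[0, M]` along which the derivative of the expected cost is affine. -/
lemma exists_affine_costDeriv (h : IsRegularCost c c' ν B) {M : ℝ} (hM : 0 ≤ M) :
    ∃ X : ℝ → ℝ, X 0 = 0 ∧ X 1 = M ∧ ∀ s ∈ Icc (0 : ℝ) 1, X s ∈ Icc 0 M ∧
      costDeriv c ν (X s) = costDeriv c ν 0 + s * (costDeriv c ν M - costDeriv c ν 0) := by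
  have hivt := intermediate_value_Icc hM (h.continuousOn_costDeriv.mono Icc_subset_Ici_self)
  have hmono := h.costDeriv_mono le_rfl hM
  have hex : ∀ s : ℝ, ∃ x, s ∈ Icc (0 : ℝ) 1 → x ∈ Icc 0 M ∧
      costDeriv c ν x = costDeriv c ν 0 + s * (costDeriv c ν M - costDeriv c ν 0) := by
    intro s
    by_cases hs : s ∈ Icc (0 : ℝ) 1
    · obtain ⟨x, hx, hgx⟩ := hivt (a := costDeriv c ν 0 + s * (costDeriv c ν M - costDeriv c ν 0))
        ⟨by nlinarith [hs.1], by nlinarith [hs.2]⟩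
      exact ⟨x, fun _ => ⟨hx, hgx⟩⟩
    · exact ⟨0, fun h => absurd h hs⟩
  choose X hX using hex
  -- Where C' is flat, the intermediate value theorem may choose other points; the ends are reset so
  -- that the grid reaches from 0 to M.
  refine ⟨fun s => if s = 0 then 0 else if s = 1 then M else X s, by simp, by simp,
    fun s hs => ?_⟩
  by_cases h0 : s = 0
  · subst h0
    simp [hM]
  by_cases h1 : s = 1
  · subst h1
    simp [hM]
  simpa [h0, h1] using hX s hs

/-! ### Growth of the derivative away from the optimum -/

section Optimal

variable {xstar α β : ℝ}

lemma costDeriv_nonneg_of_lt (h : IsRegularCost c c' ν B) (hopt : IsOptimalOrder c ν xstar)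
    {y : ℝ} (hy : xstar < y) : 0 ≤ costDeriv c ν y := by
  have h1 := h.expectedCost_gradient_le (hopt.1.trans hy.le) hopt.1
  have h2 := hopt.2 y (hopt.1.trans hy.le) hy.ne'
  nlinarith

lemma costDeriv_nonpos_of_lt (h : IsRegularCost c c' ν B) (hopt : IsOptimalOrder c ν xstar)
    {y : ℝ} (hy0 : 0 ≤ y) (hy : y < xstar) : costDeriv c ν y ≤ 0 := by
  have h1 := h.expectedCost_gradient_le hy0 hopt.1
  have h2 := hopt.2 y hy0 hy.ne
  nlinarith

lemma mul_sub_le_costDeriv_sub (h : IsRegularCost c c' ν B)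
    (hsc : LocallyStronglyConvex c ν xstar α β) {a b : ℝ} (hab : a ≤ b) (ha : 0 ≤ a)
    (hb : b ≤ demandBound ν) (haβ : xstar - β ≤ a) (hbβ : b ≤ xstar + β) :
    α * (b - a) ≤ costDeriv c ν b - costDeriv c ν a := by
  have hsub : Icc a b ⊆ Ici 0 := fun y hy => ha.trans hy.1
  have hder : ∀ y ∈ interior (Icc a b), Ici (0 : ℝ) ∈ 𝓝 y := fun y hy => by
    rw [interior_Icc] at hy
    exact Ici_mem_nhds (ha.trans_lt hy.1)
  refine (convex_Icc a b).mul_sub_le_image_sub_of_le_deriv (h.continuousOn_costDeriv.mono hsub)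
    (fun y hy => ?_) (fun y hy => ?_) a (left_mem_Icc.2 hab) b (right_mem_Icc.2 hab) hab
  · exact ((h.diff.2.differentiableAt (hder y hy))).differentiableWithinAt
  · have hy' := interior_subset hy
    rw [← derivWithin_of_mem_nhds (hder y hy)]
    exact hsc.2.2 y ⟨⟨haβ.trans hy'.1, hy'.2.trans hbβ⟩, hsub hy', hy'.2.trans hb⟩

lemma mul_sub_le_costDeriv (h : IsRegularCost c c' ν B) (hopt : IsOptimalOrder c ν xstar)
    (hsc : LocallyStronglyConvex c ν xstar α β) {x : ℝ} (hx : xstar < x)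
    (hxM : x ≤ demandBound ν) (hxβ : x ≤ xstar + β) : α * (x - xstar) ≤ costDeriv c ν x := by
  obtain ⟨hα, hβ, -⟩ := id hsc
  by_contra! hlt
  have hg := h.costDeriv_nonneg_of_lt hopt hx
  -- The sign of C' is known only strictly beyond the optimum, so the mean value inequality starts
  -- at some a > x*. The midpoint leaves x - a > C'(x)/α, a contradiction.
  set a := (xstar + (x - costDeriv c ν x / α)) / 2 with ha
  have hq : costDeriv c ν x / α < x - xstar := by
    rw [div_lt_iff₀ hα]
    linarith
  have hq0 : 0 ≤ costDeriv c ν x / α := by positivity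
  have ha1 : xstar < a := by rw [ha]; linarith
  have ha2 : a ≤ x := by rw [ha]; linarith
  have h1 := h.mul_sub_le_costDeriv_sub hsc ha2 (hopt.1.trans ha1.le) hxM (by linarith) hxβ
  have h2 := h.costDeriv_nonneg_of_lt hopt ha1
  have h3 : x - a ≤ costDeriv c ν x / α := by
    rw [le_div_iff₀ hα]
    linarith
  linarith

lemma mul_sub_le_neg_costDeriv (h : IsRegularCost c c' ν B) (hopt : IsOptimalOrder c ν xstar)
    (hsc : LocallyStronglyConvex c ν xstar α β) (hM : xstar ≤ demandBound ν) {x : ℝ}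
    (hx0 : 0 ≤ x) (hx : x < xstar) (hxβ : xstar - β ≤ x) :
    α * (xstar - x) ≤ -costDeriv c ν x := by
  obtain ⟨hα, hβ, -⟩ := id hsc
  by_contra! hlt
  have hg := h.costDeriv_nonpos_of_lt hopt hx0 hx
  set a := (xstar + (x + -costDeriv c ν x / α)) / 2 with ha
  have hq : -costDeriv c ν x / α < xstar - x := by
    rw [div_lt_iff₀ hα]
    linarith
  have hq0 : 0 ≤ -costDeriv c ν x / α := div_nonneg (by linarith) hα.le
  have ha1 : a < xstar := by rw [ha]; linarith
  have ha2 : x ≤ a := by rw [ha]; linarith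
  have h1 := h.mul_sub_le_costDeriv_sub hsc ha2 hx0 (by linarith) hxβ (by linarith)
  have h2 := h.costDeriv_nonpos_of_lt hopt (hx0.trans ha2) ha1
  have h3 : a - x ≤ -costDeriv c ν x / α := by
    rw [le_div_iff₀ hα]
    linarith
  linarith

/-- The regret of an order is controlled by a bound on the derivative there: quadratically
near the optimum, and linearly elsewhere. -/
lemma regret_le_of_costDeriv_le (h : IsRegularCost c c' ν B) (hopt : IsOptimalOrder c ν xstar)
    (hsc : LocallyStronglyConvex c ν xstar α β) (hM : xstar ≤ demandBound ν) {x W : ℝ}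
    (hx : x ∈ Icc 0 (demandBound ν)) (hW : 0 ≤ W) (hneg : -costDeriv c ν x ≤ W)
    (hpos : 0 < x → costDeriv c ν x ≤ W) :
    expectedCost c ν x - expectedCost c ν xstar ≤ demandBound ν * W ∧
    (expectedCost c ν x - expectedCost c ν xstar ≤ W ^ 2 / α ∨ α * β ≤ W) := by
  obtain ⟨hα, hβ, -⟩ := id hsc
  have hD0 : 0 ≤ demandBound ν := hx.1.trans hx.2
  have hgrad := h.expectedCost_gradient_le hx.1 hopt.1
  rcases lt_trichotomy x xstar with hlt | rfl | hlt
  · have h1 : expectedCost c ν x - expectedCost c ν xstar ≤ W * (xstar - x) := by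
      nlinarith
    refine ⟨h1.trans ?_, ?_⟩
    · nlinarith [hx.1]
    · by_cases hβx : xstar - β ≤ x
      · left
        have h2 := h.mul_sub_le_neg_costDeriv hopt hsc hM hx.1 hlt hβx
        rw [le_div_iff₀ hα]
        nlinarith
      · right
        push Not at hβx
        -- The derivative is already at most -αβ at x* - β, hence also further left.
        have h2 := h.mul_sub_le_neg_costDeriv hopt hsc hM (x := xstar - β) (hx.1.trans hβx.le)
          (by linarith) le_rfl
        have h3 := h.costDeriv_mono hx.1 hβx.le
        rw [sub_sub_cancel] at h2
        linarith
  · simp only [sub_self]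
    exact ⟨by positivity, Or.inl (by positivity)⟩
  · have hg := hpos (hopt.1.trans_lt hlt)
    have h1 : expectedCost c ν x - expectedCost c ν xstar ≤ W * (x - xstar) := by
      nlinarith
    refine ⟨h1.trans ?_, ?_⟩
    · nlinarith [hx.2, hopt.1]
    · by_cases hβx : x ≤ xstar + β
      · left
        have h2 := h.mul_sub_le_costDeriv hopt hsc hlt hx.2 hβx
        rw [le_div_iff₀ hα]
        nlinarith
      · right
        push Not at hβx
        have h2 := h.mul_sub_le_costDeriv hopt hsc (x := xstar + β) (by linarith)
          (hβx.le.trans hx.2) le_rfl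
        have h3 := h.costDeriv_mono (hopt.1.trans (by linarith)) hβx.le
        rw [add_sub_cancel_left] at h2
        linarith

end Optimal

end IsRegularCost

/-! ### Orders never exceed the largest demand -/

section Demand

variable {ν : Measure ℝ} [IsProbabilityMeasure ν]

lemma ae_le_demandBound (hbdd : BddAbove (demandSet ν)) : ∀ᵐ d ∂ν, d ≤ demandBound ν := by
  have h1 : ∀ n : ℕ, ∀ᵐ d ∂ν, d ≤ demandBound ν + 1 / ((n : ℝ) + 1) := by
    intro n
    have hn : (0 : ℝ) < 1 / ((n : ℝ) + 1) := by positivity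
    set y := demandBound ν + 1 / ((n : ℝ) + 1) with hy
    have hnot : y ∉ demandSet ν := fun hmem => by
      have := le_csSup hbdd hmem
      simp only [demandBound] at hy
      linarith
    have h1 : 1 ≤ cdf ν y := not_lt.1 hnot
    have h2 : ν (Iic y) = 1 := by
      refine le_antisymm prob_le_one ?_
      rw [← ofReal_cdf ν y]
      simpa using ENNReal.ofReal_le_ofReal h1
    exact (prob_compl_eq_zero_iff measurableSet_Iic).2 h2
  filter_upwards [ae_all_iff.2 h1] with d hd
  refine le_of_forall_pos_le_add fun ε hε => ?_
  obtain ⟨n, hn⟩ := exists_nat_one_div_lt hε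
  linarith [hd n]

lemma demandBound_nonneg (hnn : ∀ᵐ d ∂ν, 0 ≤ d) (hbdd : BddAbove (demandSet ν)) :
    0 ≤ demandBound ν := by
  refine le_of_forall_pos_le_add fun ε hε => ?_
  have h1 : ν (Iic (-ε)) = 0 := by
    refine measure_mono_null (fun d hd => ?_) hnn
    simp only [mem_compl_iff, mem_ofPred_eq, not_le]
    exact lt_of_le_of_lt hd (by linarith)
  have h2 : -ε ∈ demandSet ν := by
    simp [demandSet, cdf_eq_real, measureReal_def, h1]
  have := le_csSup hbdd h2
  simp only [demandBound]
  linarith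

variable {c c' : ℝ → ℝ → ℝ}

/-- Beyond the demand, the cost increases in the order quantity. -/
lemma cost_le_of_demand_le (hsub : IsSubgradientFunction c c') {d x y : ℝ} (hd : 0 ≤ d)
    (hmin : ∃ x, 0 ≤ x ∧ x ≤ d ∧ ∀ y, 0 ≤ y → c x d ≤ c y d) (hx : d ≤ x) (hxy : x ≤ y) :
    c x d ≤ c y d := by
  obtain ⟨z, hz0, hzd, hz⟩ := hmin
  have hx0 : 0 ≤ x := hd.trans hx
  rcases (hzd.trans hx).eq_or_lt with rfl | hlt
  · exact hz y (hx0.trans hxy)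
  · have h1 := hsub d hd x hx0 z hz0
    have h2 := hsub d hd x hx0 y (hx0.trans hxy)
    have h3 := hz x hx0
    have h4 : 0 ≤ c' x d := by nlinarith
    nlinarith

/-- Almost every cost is nondecreasing beyond D̄, so otherwise D̄ would do at least as well as the
unique minimizer. -/
lemma optimalOrder_le_demandBound {B xstar : ℝ} (h : IsRegularCost c c' ν B)
    (hbdd : BddAbove (demandSet ν))
    (hmin : ∀ d, 0 ≤ d → ∃ x, 0 ≤ x ∧ x ≤ d ∧ ∀ y, 0 ≤ y → c x d ≤ c y d)
    (hopt : IsOptimalOrder c ν xstar) : xstar ≤ demandBound ν := by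
  by_contra! hlt
  have h0 := demandBound_nonneg h.nonneg hbdd
  refine absurd (hopt.2 _ h0 hlt.ne) (not_lt.2 ?_)
  refine integral_mono_ae (h.integrable _ h0) (h.integrable _ hopt.1) ?_
  filter_upwards [h.nonneg, ae_le_demandBound hbdd] with d hd hdM
  exact cost_le_of_demand_le h.subgradient hd (hmin d hd) hdM hlt.le

/-- If x > M, then M is an empirical minimizer too, as all sampled costs are nondecreasing beyond M;
the tie-breaking rule excludes this. -/
lemma saaOrder_le {M x : ℝ} {t : ℕ} {d : ℕ → ℝ} (hsub : IsSubgradientFunction c c') (hM : 0 ≤ M)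
    (hmin : ∀ d, 0 ≤ d → ∃ x, 0 ≤ x ∧ x ≤ d ∧ ∀ y, 0 ≤ y → c x d ≤ c y d)
    (hd : ∀ i, 0 ≤ d i ∧ d i ≤ M) (hx : IsSAAOrder c M t d x) : x ≤ M := by
  by_contra! hlt
  refine lt_irrefl M (hx.2 hlt M ⟨hM, fun y hy => le_trans ?_ (hx.1.2 y hy)⟩)
  refine mul_le_mul_of_nonneg_left (Finset.sum_le_sum fun i _ => ?_) (by positivity)
  exact cost_le_of_demand_le hsub (hd i).1 (hmin _ (hd i).1) (hd i).2 hlt.le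

end Demand

/-- A discrete crossing argument, needed because the grid in the order quantity is not known to be
monotone. -/
lemma exists_lt_le_succ {X : ℕ → ℝ} {x : ℝ} {N : ℕ} (h0 : X 0 < x) (hN : x ≤ X N) :
    ∃ j < N, X j < x ∧ x ≤ X (j + 1) := by
  induction N with
  | zero => exact absurd h0 (not_lt.2 hN)
  | succ N ih =>
    by_cases h : x ≤ X N
    · obtain ⟨j, hj, hj'⟩ := ih h
      exact ⟨j, hj.trans (Nat.lt_succ_self N), hj'⟩
    · exact ⟨N, Nat.lt_succ_self N, not_le.1 h, hN⟩

lemma abs_le_sqrt_sqrt {z q : ℝ} (h : z ^ 4 ≤ q) : |z| ≤ √(√q) := by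
  refine Real.abs_le_sqrt (Real.le_sqrt_of_sq_le ?_)
  rwa [← pow_mul]

/-! ### Uniform error of the empirical gradient -/

section Error

variable {Ω : Type*} [MeasurableSpace Ω] {P : Measure Ω} [IsProbabilityMeasure P]
  {ν : Measure ℝ} [IsProbabilityMeasure ν] {D : ℕ → Ω → ℝ} {c c' : ℝ → ℝ → ℝ} {B : ℝ}

/-- The uniform distance between the sample average subgradient and the derivative of the
expected cost is of order `1 / √t`, with fourth moments. At the order quantity `0` only an upper
bound on the sample average subgradient is available. -/
lemma exists_uniform_gradient_error (h : IsRegularCost c c' ν B) (hD : ∀ i, HasLaw (D i) ν P)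
    (hind : iIndepFun D P) (hB : 0 ≤ B) {M : ℝ} (hM : 0 ≤ M) {t : ℕ} (ht : 1 ≤ t) :
    ∃ Y : Ω → ℝ, AEMeasurable Y P ∧ (∀ ω, 0 ≤ Y ω) ∧ Integrable (fun ω => Y ω ^ 4) P ∧
      ∫ ω, Y ω ^ 4 ∂P ≤ (100 * B) ^ 4 ∧
      ∀ᵐ ω ∂P, ∀ x ∈ Icc 0 M,
        empiricalGradient c' t (fun i => D i ω) x ≤ costDeriv c ν x + Y ω / √t ∧
        (0 < x → costDeriv c ν x ≤ empiricalGradient c' t (fun i => D i ω) x + Y ω / √t) := by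
  obtain ⟨X, hX0, hX1, hX⟩ := h.exists_affine_costDeriv hM
  set Δ := costDeriv c ν M - costDeriv c ν 0 with hΔ
  have hΔ0 : 0 ≤ Δ := sub_nonneg.2 (h.costDeriv_mono le_rfl hM)
  have hΔB : Δ ≤ 2 * B := by
    have h1 := (abs_le.1 (h.abs_costDeriv_le (ν := ν) hM)).2
    have h2 := (abs_le.1 (h.abs_costDeriv_le (ν := ν) (le_refl (0 : ℝ)))).1
    linarith
  -- 4^K ≤ t < 4^(K+1): coarse enough for the chaining bound, fine enough that C' varies by at most
  -- 4B/√t between grid neighbours.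
  set K := Nat.log 4 t with hK
  have hKt : 4 ^ K ≤ t := Nat.pow_log_le_self 4 (by omega)
  have htK : t < 4 ^ (K + 1) := Nat.lt_pow_succ_log_self (by norm_num) t
  have hL : ∀ s ∈ Icc (0 : ℝ) 1, ∀ s' ∈ Icc (0 : ℝ) 1,
      ∫ d, |costRightDeriv c (X s) d - costRightDeriv c (X s') d| ∂ν ≤ 2 * B * |s - s'| := by
    intro s hs s' hs'
    rw [h.integral_abs_costRightDeriv_sub (hX s hs).1.1 (hX s' hs').1.1, (hX s hs).2,
      (hX s' hs').2, add_sub_add_left_eq_sub, ← sub_mul, abs_mul, abs_of_nonneg hΔ0, mul_comm]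
    gcongr
  obtain ⟨Q, hQi, hQ0, hQE, hQb⟩ := exists_chaining_bound
    (φ := fun s => costRightDeriv c (X s)) hD hind hB
    (fun s hs => h.aemeasurable_costRightDeriv (hX s hs).1.1)
    (fun s hs => h.ae_abs_costRightDeriv_le (hX s hs).1.1) hL hKt
  have ht0 : (0 : ℝ) < t := by exact_mod_cast ht
  have hst : 0 < √(t : ℝ) := Real.sqrt_pos.2 ht0
  have hsq : √(t : ℝ) ^ 2 = t := Real.sq_sqrt ht0.le
  have hmesh : Δ / 2 ^ K ≤ 4 * B / √t := by
    have h1 : √(t : ℝ) ≤ 2 ^ (K + 1) := by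
      refine Real.sqrt_le_iff.2 ⟨by positivity, ?_⟩
      rw [← pow_mul, mul_comm, pow_mul]
      norm_num
      exact_mod_cast htK.le
    rw [div_le_div_iff₀ (by positivity) hst]
    rw [pow_succ] at h1
    have := mul_le_mul hΔB h1 hst.le (by positivity)
    linarith
  -- The factor 8 is (1 + 1)³ from equal weights; then 8(4⁴ + 10⁶) ≤ 100⁴.
  have hY4 : ∀ ω, (4 * B + √(√(Q ω)) / √t) ^ 4 ≤ 8 * ((4 * B) ^ 4 + Q ω / t ^ 2) := by
    intro ω
    have e1 : (√(√(Q ω)) / √t) ^ 4 = Q ω / t ^ 2 := by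
      rw [div_pow, show (4 : ℕ) = 2 * 2 by norm_num, pow_mul, pow_mul, hsq,
        Real.sq_sqrt (Real.sqrt_nonneg _), Real.sq_sqrt (hQ0 ω)]
    have := add_pow_four_le (a := 4 * B) (b := √(√(Q ω)) / √t) (A := (4 * B) ^ 4)
      (Q := (√(√(Q ω)) / √t) ^ 4) one_pos one_pos (by simp) (by simp)
    rw [e1] at this
    linarith
  have hYm : AEMeasurable (fun ω => 4 * B + √(√(Q ω)) / √t) P :=
    ((hQi.aemeasurable.sqrt.sqrt).div_const _).const_add _
  have hbi : Integrable (fun ω => 8 * ((4 * B) ^ 4 + Q ω / t ^ 2)) P :=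
    ((integrable_const _).add (hQi.div_const _)).const_mul _
  have hYi : Integrable (fun ω => (4 * B + √(√(Q ω)) / √t) ^ 4) P := by
    refine hbi.mono' (hYm.pow_const 4).aestronglyMeasurable (ae_of_all _ fun ω => ?_)
    rw [Real.norm_of_nonneg (by positivity)]
    exact hY4 ω
  refine ⟨fun ω => 4 * B + √(√(Q ω)) / √t, hYm, fun ω => by positivity, hYi, ?_, ?_⟩
  · refine (integral_mono hYi hbi hY4).trans ?_
    rw [integral_const_mul, integral_add (integrable_const _) (hQi.div_const _), integral_div]
    simp only [integral_const, probReal_univ, one_smul]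
    have : (∫ ω, Q ω ∂P) / (t : ℝ) ^ 2 ≤ 10 ^ 6 * B ^ 4 := by
      rw [div_le_iff₀ (by positivity)]
      linarith
    have hB4 : 0 ≤ B ^ 4 := by positivity
    nlinarith
  · filter_upwards [ae_all_iff.2 fun i => HasLaw.ae_comp (hD i) h.nonneg] with ω hω x hx
    have hemp : ∀ j : ℕ, j ≤ 2 ^ K →
        |(1 / (t : ℝ)) * ∑ i ∈ Finset.range t, costRightDeriv c (X (j / 2 ^ K)) (D i ω)
          - costDeriv c ν (X (j / 2 ^ K))| ≤ √(√(Q ω)) / t := by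
      intro j hj
      have h1 := abs_le_sqrt_sqrt (hQb ω j hj)
      have hj0 := (hX _ (dyadic_mem_Icc hj)).1.1
      have h2 : (1 / (t : ℝ)) * ∑ i ∈ Finset.range t, costRightDeriv c (X (j / 2 ^ K)) (D i ω)
          - costDeriv c ν (X (j / 2 ^ K))
          = centredSum ν D t (costRightDeriv c (X (j / 2 ^ K))) ω / t := by
        rw [centredSum, Finset.sum_sub_distrib, h.integral_costRightDeriv hj0]
        simp
        field_simp
      rw [h2, abs_div, abs_of_pos ht0]
      gcongr
    have hY : (4 * B + √(√(Q ω)) / √t) / √t = 4 * B / √t + √(√(Q ω)) / t := by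
      rw [add_div, div_div, Real.mul_self_sqrt ht0.le]
    have hstep : ∀ j : ℕ, j < 2 ^ K → costDeriv c ν (X ((j + 1 : ℕ) / 2 ^ K))
        = costDeriv c ν (X (j / 2 ^ K)) + Δ / 2 ^ K := by
      intro j hj
      rw [(hX _ (dyadic_mem_Icc hj)).2, (hX _ (dyadic_mem_Icc hj.le)).2]
      push_cast
      ring
    have hupper : ∀ y, 0 ≤ y → x ≤ y → empiricalGradient c' t (fun i => D i ω) x
        ≤ (1 / (t : ℝ)) * ∑ i ∈ Finset.range t, costRightDeriv c y (D i ω) := fun y hy hxy =>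
      mul_le_mul_of_nonneg_left (Finset.sum_le_sum fun i _ =>
        (h.le_costRightDeriv (hω i) hx.1).trans (h.costRightDeriv_mono (hω i) hx.1 hxy))
        (by positivity)
    have hlower : ∀ y, 0 ≤ y → y < x →
        (1 / (t : ℝ)) * ∑ i ∈ Finset.range t, costRightDeriv c y (D i ω)
          ≤ empiricalGradient c' t (fun i => D i ω) x := fun y hy hxy =>
      mul_le_mul_of_nonneg_left (Finset.sum_le_sum fun i _ =>
        h.costRightDeriv_le (hω i) hy hxy) (by positivity)
    have hX0' : X ((0 : ℕ) / 2 ^ K) = 0 := by simpa using hX0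
    have hB' : 0 ≤ 4 * B / √(t : ℝ) := by positivity
    simp only [hY]
    rcases hx.1.eq_or_lt with rfl | hxpos
    -- No order quantity lies below 0 to bracket the subgradient from below, so only the upper
    -- estimate remains.
    · refine ⟨?_, fun h => absurd h (lt_irrefl _)⟩
      have h1 := hemp 0 (Nat.zero_le _)
      rw [hX0'] at h1
      have h2 := hupper 0 le_rfl le_rfl
      linarith [(abs_le.1 h1).2]
    · have hlast : x ≤ X ((2 ^ K : ℕ) / 2 ^ K) := by
        have : ((2 ^ K : ℕ) : ℝ) / 2 ^ K = 1 := by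
          push_cast
          exact div_self (by positivity)
        rw [this, hX1]
        exact hx.2
      -- The right derivatives at the two neighbours bracket the subgradient at x; one mesh step of
      -- C' and one grid error are lost.
      obtain ⟨j, hj, hjx, hxj⟩ := exists_lt_le_succ (X := fun j : ℕ => X (j / 2 ^ K))
        (by simpa only [hX0'] using hxpos) hlast
      have m1 := (hX _ (dyadic_mem_Icc hj.le)).1.1
      have m2 := (hX _ (dyadic_mem_Icc (Nat.succ_le_of_lt hj))).1.1
      have g1 := h.costDeriv_mono (ν := ν) m1 hjx.le
      have g2 := h.costDeriv_mono (ν := ν) hx.1 hxj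
      have g3 := hstep j hj
      have e1 := abs_le.1 (hemp j hj.le)
      have e2 := abs_le.1 (hemp (j + 1) hj)
      have u := hupper _ m2 hxj
      have l := hlower _ m1 hjx
      constructor
      · linarith [e2.2]
      · intro _
        linarith [e1.1]

end Error

/-! ### From fourth moments to expected regret -/

section MomentBounds

variable {Ω : Type*} [MeasurableSpace Ω] {P : Measure Ω} [IsProbabilityMeasure P]

/-- Triangle inequality in `L⁴` for adding a constant. -/
lemma integral_const_add_pow_four_le {Y : Ω → ℝ} {a m : ℝ} (hYm : AEMeasurable Y P)
    (hYi : Integrable (fun ω => Y ω ^ 4) P) (hYE : ∫ ω, Y ω ^ 4 ∂P ≤ m ^ 4) (ha : 0 ≤ a)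
    (hm : 0 < m) : Integrable (fun ω => (a + Y ω) ^ 4) P ∧
      ∫ ω, (a + Y ω) ^ 4 ∂P ≤ (a + m) ^ 4 := by
  rcases ha.eq_or_lt with rfl | ha
  · simpa using ⟨hYi, hYE⟩
  have hle : ∀ ω, (a + Y ω) ^ 4 ≤ (a + m) ^ 3 * (a + (m ^ 3)⁻¹ * Y ω ^ 4) := fun ω =>
    add_pow_four_le ha hm (le_of_eq (by ring)) (by rw [mul_inv_cancel_left₀ (by positivity)])
  have hbi : Integrable (fun ω => (a + m) ^ 3 * (a + (m ^ 3)⁻¹ * Y ω ^ 4)) P :=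
    ((integrable_const _).add (hYi.const_mul _)).const_mul _
  have hi : Integrable (fun ω => (a + Y ω) ^ 4) P := by
    refine hbi.mono' ((hYm.const_add a).pow_const 4).aestronglyMeasurable
      (ae_of_all _ fun ω => ?_)
    rw [Real.norm_of_nonneg (by positivity)]
    exact hle ω
  refine ⟨hi, (integral_mono hi hbi hle).trans ?_⟩
  rw [integral_const_mul, integral_add (integrable_const _) (hYi.const_mul _), integral_const_mul]
  simp only [integral_const, probReal_univ, one_smul]
  have h1 : (m ^ 3)⁻¹ * ∫ ω, Y ω ^ 4 ∂P ≤ m := by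
    rw [inv_mul_le_iff₀ (by positivity)]
    linarith [show m ^ 3 * m = m ^ 4 by ring]
  calc (a + m) ^ 3 * (a + (m ^ 3)⁻¹ * ∫ ω, Y ω ^ 4 ∂P) ≤ (a + m) ^ 3 * (a + m) := by gcongr
    _ = (a + m) ^ 4 := by ring

/-- Lower moments are controlled by the fourth moment. -/
lemma integral_le_of_integral_pow_four_le {U : Ω → ℝ} {A : ℝ} (hUm : AEMeasurable U P)
    (hU0 : ∀ ω, 0 ≤ U ω) (hUi : Integrable (fun ω => U ω ^ 4) P)
    (hUE : ∫ ω, U ω ^ 4 ∂P ≤ A ^ 4) (hA : 0 < A) :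
    (Integrable U P ∧ ∫ ω, U ω ∂P ≤ A) ∧
    (Integrable (fun ω => U ω ^ 2) P ∧ ∫ ω, U ω ^ 2 ∂P ≤ A ^ 2) := by
  have aux : ∀ (k : ℕ) (p q : ℝ), 0 ≤ p → p * A ^ 4 + q = A ^ k →
      (∀ ω, U ω ^ k ≤ p * U ω ^ 4 + q) →
      Integrable (fun ω => U ω ^ k) P ∧ ∫ ω, U ω ^ k ∂P ≤ A ^ k := by
    intro k p q hp hpq hle
    have hbi : Integrable (fun ω => p * U ω ^ 4 + q) P :=
      (hUi.const_mul _).add (integrable_const _)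
    have hi : Integrable (fun ω => U ω ^ k) P := by
      refine hbi.mono' (hUm.pow_const k).aestronglyMeasurable (ae_of_all _ fun ω => ?_)
      rw [Real.norm_of_nonneg (pow_nonneg (hU0 ω) k)]
      exact hle ω
    refine ⟨hi, (integral_mono hi hbi hle).trans ?_⟩
    rw [integral_add (hUi.const_mul _) (integrable_const _), integral_const_mul]
    simp only [integral_const, probReal_univ, one_smul]
    rw [← hpq]
    gcongr
  constructor
  -- Young's inequality: p, q are the coefficients of the tangent to u ↦ u^(1/4) at A⁴, so equality
  -- holds at U = A. The second moment uses u ↦ u^(1/2).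
  · have := aux 1 (1 / (4 * A ^ 3)) (3 * A / 4) (by positivity) (by field_simp; ring)
      (fun ω => by
        have h1 : 1 / (4 * A ^ 3) * U ω ^ 4 + 3 * A / 4
            = (U ω ^ 4 + 3 * A ^ 4) / (4 * A ^ 3) := by
          field_simp
        rw [h1, le_div_iff₀ (by positivity)]
        have h2 : 0 ≤ (U ω - A) ^ 2 * ((U ω + A) ^ 2 + 2 * A ^ 2) := by positivity
        nlinarith)
    simpa using this
  · refine aux 2 (1 / (2 * A ^ 2)) (A ^ 2 / 2) (by positivity) (by field_simp; ring) fun ω => ?_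
    have h1 : 1 / (2 * A ^ 2) * U ω ^ 4 + A ^ 2 / 2 = (U ω ^ 4 + A ^ 4) / (2 * A ^ 2) := by
      field_simp
    rw [h1, le_div_iff₀ (by positivity)]
    nlinarith [sq_nonneg (U ω ^ 2 - A ^ 2)]

/-- If a random regret `R` is at most `M W`, and at most `W² / α` unless `W ≥ γ`, where `W = U / √t`
and `U` has fourth moment at most `A⁴`, then its expectation is `O(1 / t)` up to a term that is
summable in `t`. -/
lemma integral_regret_le {R U : Ω → ℝ} {A M α γ : ℝ} {t : ℕ} (ht : 1 ≤ t)
    (hUm : AEMeasurable U P) (hU0 : ∀ ω, 0 ≤ U ω) (hUi : Integrable (fun ω => U ω ^ 4) P)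
    (hUE : ∫ ω, U ω ^ 4 ∂P ≤ A ^ 4) (hA : 0 < A) (hM : 0 ≤ M) (hα : 0 < α) (hγ : 0 < γ)
    (hR : AEMeasurable R P) (hR0 : ∀ᵐ ω ∂P, 0 ≤ R ω)
    (hR1 : ∀ᵐ ω ∂P, R ω ≤ M * (U ω / √t) ∧
      (R ω ≤ (U ω / √t) ^ 2 / α ∨ γ ≤ U ω / √t)) :
    Integrable R P ∧ ∫ ω, R ω ∂P ≤ M * (A / √t) ∧
      ∫ ω, R ω ∂P ≤ A ^ 2 / α * (1 / t) + M * (4 * (A / √t) / (1 + γ * √t / A) ^ 2) := by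
  obtain ⟨⟨hi1, hE1⟩, hi2, hE2⟩ := integral_le_of_integral_pow_four_le hUm hU0 hUi hUE hA
  have ht0 : (0 : ℝ) < t := by exact_mod_cast ht
  have hst : 0 < √(t : ℝ) := Real.sqrt_pos.2 ht0
  have hsq : √(t : ℝ) ^ 2 = t := Real.sq_sqrt ht0.le
  have hi1' : Integrable (fun ω => M * (U ω / √t)) P := (hi1.div_const _).const_mul _
  have hi2' : Integrable (fun ω => (U ω / √t) ^ 2 / α) P := by
    simp only [div_pow]
    exact (hi2.div_const _).div_const _
  have hRi : Integrable R P := by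
    refine hi1'.mono' hR.aestronglyMeasurable ?_
    filter_upwards [hR0, hR1] with ω h0 h1
    rw [Real.norm_of_nonneg h0]
    exact h1.1
  have hEM : ∫ ω, M * (U ω / √t) ∂P ≤ M * (A / √t) := by
    rw [integral_const_mul, integral_div]
    gcongr
  have hE2' : ∫ ω, (U ω / √t) ^ 2 / α ∂P ≤ A ^ 2 / α * (1 / t) := by
    simp only [div_pow, hsq]
    rw [integral_div, integral_div]
    calc (∫ ω, U ω ^ 2 ∂P) / t / α ≤ A ^ 2 / t / α := by gcongr
      _ = _ := by ring
  refine ⟨hRi, ?_, ?_⟩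
  · refine (integral_mono_ae hRi hi1' ?_).trans hEM
    filter_upwards [hR1] with ω h1 using h1.1
  · set r := γ * √t / A with hr
    have hr0 : 0 < r := by positivity
    -- The tail is bounded by the first moment if r ≤ 1 and by Markov's inequality at order four,
    -- giving r⁻³, if r ≥ 1. Both are below 4/(1 + r)², a form that telescopes.
    rcases le_total r 1 with hr1 | hr1
    · have hle : ∫ ω, R ω ∂P ≤ ∫ ω, ((U ω / √t) ^ 2 / α + M * (U ω / √t)) ∂P := by
        refine integral_mono_ae hRi (hi2'.add hi1') ?_
        filter_upwards [hR1] with ω h1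
        have : 0 ≤ (U ω / √t) ^ 2 / α := by positivity
        linarith [h1.1]
      refine hle.trans ?_
      rw [integral_add hi2' hi1']
      refine add_le_add hE2' (hEM.trans (mul_le_mul_of_nonneg_left ?_ hM))
      rw [le_div_iff₀ (by positivity)]
      have : (1 + r) ^ 2 ≤ 4 := by nlinarith
      have hu : 0 ≤ A / √t := by positivity
      nlinarith
    · have hi4 : Integrable (fun ω => M * ((U ω / √t) ^ 4 / γ ^ 3)) P := by
        simp only [div_pow]
        exact ((hUi.div_const _).div_const _).const_mul _
      have hle : ∫ ω, R ω ∂P ≤ ∫ ω, ((U ω / √t) ^ 2 / α + M * ((U ω / √t) ^ 4 / γ ^ 3)) ∂P := by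
        refine integral_mono_ae hRi (hi2'.add hi4) ?_
        filter_upwards [hR1] with ω h1
        have hW : 0 ≤ U ω / √t := div_nonneg (hU0 ω) hst.le
        have h2 : 0 ≤ (U ω / √t) ^ 2 / α := by positivity
        rcases h1.2 with h | h
        · have : 0 ≤ M * ((U ω / √t) ^ 4 / γ ^ 3) := by positivity
          linarith
        · have h3 : U ω / √t ≤ (U ω / √t) ^ 4 / γ ^ 3 := by
            rw [le_div_iff₀ (by positivity)]
            calc U ω / √t * γ ^ 3 ≤ U ω / √t * (U ω / √t) ^ 3 := by gcongr
              _ = _ := by ring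
          have := mul_le_mul_of_nonneg_left h3 hM
          linarith [h1.1]
      refine hle.trans ?_
      rw [integral_add hi2' hi4]
      refine add_le_add hE2' ?_
      rw [integral_const_mul]
      gcongr
      simp only [div_pow]
      rw [integral_div, integral_div]
      have h1 : (∫ ω, U ω ^ 4 ∂P) / √(t : ℝ) ^ 4 / γ ^ 3 ≤ A ^ 4 / √(t : ℝ) ^ 4 / γ ^ 3 := by
        gcongr
      refine h1.trans ?_
      have h2 : A ^ 4 / √(t : ℝ) ^ 4 / γ ^ 3 = (A / √t) / r ^ 3 := by
        rw [hr]
        field_simp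
      rw [h2, div_le_div_iff₀ (by positivity) (by positivity)]
      have h3 : (1 + r) ^ 2 ≤ 4 * r ^ 3 := by nlinarith [sq_nonneg r]
      have hu : 0 ≤ A / √t := by positivity
      calc A / √t * (1 + r) ^ 2 ≤ A / √t * (4 * r ^ 3) := by gcongr
        _ = _ := by ring

end MomentBounds

/-! ### Summation over the horizon -/

section Summation

/-- The derivative of q√t/(1 + q√t) is q/(2√t(1 + q√t)²). This primitive is bounded by 1, so the
tail terms sum to at most 8/q. -/
lemma one_div_sqrt_div_sq_le {q : ℝ} (hq : 0 < q) (n : ℕ) :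
    4 * (1 / √((n + 1 : ℕ) : ℝ)) / (1 + q * √((n + 1 : ℕ) : ℝ)) ^ 2
      ≤ 8 / q * (q * √((n + 1 : ℕ) : ℝ) / (1 + q * √((n + 1 : ℕ) : ℝ))
        - q * √(n : ℝ) / (1 + q * √(n : ℝ))) := by
  have hn0 : (0 : ℝ) ≤ n := by positivity
  have hb0 : 0 < √((n + 1 : ℕ) : ℝ) := Real.sqrt_pos.2 (by positivity)
  have ha0 : 0 ≤ √(n : ℝ) := Real.sqrt_nonneg _
  have hab : √(n : ℝ) ≤ √((n + 1 : ℕ) : ℝ) := Real.sqrt_le_sqrt (by push_cast; linarith)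
  have ha2 : √(n : ℝ) ^ 2 = n := Real.sq_sqrt hn0
  have hb2 : √((n + 1 : ℕ) : ℝ) ^ 2 = n + 1 := by
    rw [Real.sq_sqrt (by positivity)]
    push_cast
    ring
  set a := √(n : ℝ)
  set b := √((n + 1 : ℕ) : ℝ)
  have hdiff : q * b / (1 + q * b) - q * a / (1 + q * a)
      = q * (b - a) / ((1 + q * b) * (1 + q * a)) := by
    field_simp
    ring
  have h1 : 1 / (2 * b) ≤ b - a := by
    rw [div_le_iff₀ (by positivity)]
    nlinarith
  have h2 : q * (1 / (2 * b)) / (1 + q * b) ^ 2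
      ≤ q * (b - a) / ((1 + q * b) * (1 + q * a)) := by
    have : (1 + q * b) * (1 + q * a) ≤ (1 + q * b) ^ 2 := by
      rw [sq]
      gcongr
    gcongr
  rw [hdiff]
  calc 4 * (1 / b) / (1 + q * b) ^ 2
      = 8 / q * (q * (1 / (2 * b)) / (1 + q * b) ^ 2) := by
        field_simp
        ring
    _ ≤ _ := by gcongr

lemma one_div_succ_le_log_sub {n : ℕ} (hn : 1 ≤ n) :
    1 / ((n + 1 : ℕ) : ℝ) ≤ Real.log ((n + 1 : ℕ) : ℝ) - Real.log n := by
  have hn0 : (0 : ℝ) < n := by exact_mod_cast hn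
  rw [← Real.log_div (by positivity) (by positivity)]
  refine le_trans (le_of_eq ?_) (Real.one_sub_inv_le_log_of_pos (by positivity))
  push_cast
  field_simp
  ring

/-- Summation of the one-period regret bounds over the horizon. -/
lemma sum_regret_le {a : ℕ → ℝ} {A M α γ : ℝ} (hA : 0 < A) (hM : 0 ≤ M) (hα : 0 < α)
    (hγ : 0 < γ) {T : ℕ} (hT : 1 ≤ T)
    (h1 : ∀ t ∈ Finset.Icc 1 T, a t ≤ M * (A / √t))
    (h2 : ∀ t ∈ Finset.Icc 1 T,
      a t ≤ A ^ 2 / α * (1 / t) + M * (4 * (A / √t) / (1 + γ * √t / A) ^ 2)) :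
    ∑ t ∈ Finset.Icc 1 T, a t ≤ M * A + A ^ 2 / α * Real.log T + 8 * M * A ^ 2 / γ := by
  set q := γ / A with hq
  have hq0 : 0 < q := by positivity
  have key : ∀ n, 1 ≤ n → n ≤ T → ∑ t ∈ Finset.Icc 1 n, a t
      ≤ M * A + A ^ 2 / α * Real.log n
        + M * A * (8 / q) * (q * √(n : ℝ) / (1 + q * √(n : ℝ))) := by
    intro n hn
    induction n, hn using Nat.le_induction with
    | base =>
      intro hT
      -- The first period uses the linear bound, so that the harmonic sum starts at 2 and
      -- contributes only ln T.
      have := h1 1 (by simp [hT])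
      have hpos : 0 ≤ M * A * (8 / q) * (q * √((1 : ℕ) : ℝ) / (1 + q * √((1 : ℕ) : ℝ))) := by
        positivity
      simp only [Finset.Icc_self, Finset.sum_singleton]
      simp only [Nat.cast_one, Real.sqrt_one, div_one, Real.log_one, mul_zero, add_zero] at *
      linarith
    | succ n hn ih =>
      intro hnT
      rw [Finset.sum_Icc_succ_top (by omega)]
      have hi := ih (by omega)
      have hs := h2 (n + 1) (by simp [hnT])
      have e1 := mul_le_mul_of_nonneg_left (one_div_succ_le_log_sub hn)
        (show 0 ≤ A ^ 2 / α by positivity)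
      have e2 := mul_le_mul_of_nonneg_left (one_div_sqrt_div_sq_le hq0 n)
        (show 0 ≤ M * A by positivity)
      have e3 : M * (4 * (A / √((n + 1 : ℕ) : ℝ)) / (1 + γ * √((n + 1 : ℕ) : ℝ) / A) ^ 2)
          = M * A * (4 * (1 / √((n + 1 : ℕ) : ℝ)) / (1 + q * √((n + 1 : ℕ) : ℝ)) ^ 2) := by
        have : γ * √((n + 1 : ℕ) : ℝ) / A = q * √((n + 1 : ℕ) : ℝ) := by rw [hq]; ring
        rw [this]
        ring
      rw [e3] at hs
      linarith
  refine (key T hT le_rfl).trans ?_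
  have h3 : q * √(T : ℝ) / (1 + q * √(T : ℝ)) ≤ 1 := by
    rw [div_le_one (by positivity)]
    linarith
  have h4 : M * A * (8 / q) * (q * √(T : ℝ) / (1 + q * √(T : ℝ))) ≤ M * A * (8 / q) * 1 := by
    gcongr
  have h5 : M * A * (8 / q) * 1 = 8 * M * A ^ 2 / γ := by
    rw [hq]
    field_simp
  linarith

end Summation

/-! ### Regret of the SAA order and the final constants -/

section Regret

variable {Ω : Type*} [MeasurableSpace Ω] {P : Measure Ω} [IsProbabilityMeasure P]
  {ν : Measure ℝ} [IsProbabilityMeasure ν] {D : ℕ → Ω → ℝ} {c c' : ℝ → ℝ → ℝ} {B : ℝ}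

/-- If B ≤ 0, then C' vanishes and x* + 1 is as good as the unique minimizer. Positivity of B makes
A = C₁ + 100B positive. -/
lemma IsRegularCost.bound_pos {xstar : ℝ} (h : IsRegularCost c c' ν B)
    (hopt : IsOptimalOrder c ν xstar) : 0 < B := by
  by_contra! hB
  have hx : 0 ≤ xstar + 1 := by linarith [hopt.1]
  have h1 := (abs_le.1 (h.abs_costDeriv_le hx)).2
  have h2 := h.expectedCost_gradient_le hx hopt.1
  have h3 := hopt.2 (xstar + 1) hx (by linarith)
  have h4 := (abs_le.1 (h.abs_costDeriv_le hx)).1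
  nlinarith

/-- Expected regret of the sample average approximation after `t` periods. -/
lemma IsRegularCost.integral_regret_le (h : IsRegularCost c c' ν B)
    (hD : ∀ i, HasLaw (D i) ν P) (hind : iIndepFun D P) (hbdd : BddAbove (demandSet ν))
    (hmin : ∀ d, 0 ≤ d → ∃ x, 0 ≤ x ∧ x ≤ d ∧ ∀ y, 0 ≤ y → c x d ≤ c y d)
    {C₁ : ℝ} (hC₁ : 0 ≤ C₁) {t : ℕ} (ht : 1 ≤ t) {xhat : Ω → ℝ} (hxm : AEMeasurable xhat P)
    (hsaa : ∀ᵐ ω ∂P, IsSAAOrder c (demandBound ν) t (fun i => D i ω) (xhat ω))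
    (hgrad : ∀ᵐ ω ∂P, |empiricalGradient c' t (fun i => D i ω) (xhat ω)| ≤ C₁ / √(t : ℝ))
    {xstar α β : ℝ} (hopt : IsOptimalOrder c ν xstar)
    (hsc : LocallyStronglyConvex c ν xstar α β) :
    Integrable (fun ω => expectedCost c ν (xhat ω) - expectedCost c ν xstar) P ∧
    ∫ ω, (expectedCost c ν (xhat ω) - expectedCost c ν xstar) ∂P
      ≤ demandBound ν * ((C₁ + 100 * B) / √t) ∧
    ∫ ω, (expectedCost c ν (xhat ω) - expectedCost c ν xstar) ∂P
      ≤ (C₁ + 100 * B) ^ 2 / α * (1 / t)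
        + demandBound ν * (4 * ((C₁ + 100 * B) / √t)
          / (1 + α * β * √t / (C₁ + 100 * B)) ^ 2) := by
  have hB := h.bound_pos hopt
  have hM := demandBound_nonneg h.nonneg hbdd
  obtain ⟨Y, hYm, hY0, hYi, hYE, hYb⟩ := exists_uniform_gradient_error h hD hind hB.le hM ht
  obtain ⟨hUi, hUE⟩ := integral_const_add_pow_four_le hYm hYi hYE hC₁
    (show 0 < 100 * B by positivity)
  have hrange : ∀ᵐ ω ∂P, xhat ω ∈ Icc 0 (demandBound ν) := by
    filter_upwards [hsaa, ae_all_iff.2 fun i => HasLaw.ae_comp (hD i) h.nonneg,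
      ae_all_iff.2 fun i => HasLaw.ae_comp (hD i) (ae_le_demandBound hbdd)] with ω h1 h2 h3
    exact ⟨h1.1.1, saaOrder_le h.subgradient hM hmin (fun i => ⟨h2 i, h3 i⟩) h1⟩
  refine Newsvendor.integral_regret_le ht (hYm.const_add C₁) (fun ω => add_nonneg hC₁ (hY0 ω))
    hUi hUE (by positivity) hM hsc.1 (mul_pos hsc.1 hsc.2.1) ?_ ?_ ?_
  -- The expected cost is controlled only on [0, ∞); truncation at 0 gives a continuous function
  -- agreeing with it at the order.
  · have hcont : Continuous (fun x : ℝ => expectedCost c ν (max 0 x)) :=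
      h.continuousOn_expectedCost.comp_continuous (by fun_prop) fun x => le_max_left 0 x
    refine ((hcont.measurable.comp_aemeasurable hxm).congr ?_).sub_const _
    filter_upwards [hrange] with ω hω
    simp [max_eq_right hω.1]
  · filter_upwards [hrange] with ω hω
    by_cases hx : xhat ω = xstar
    · simp [hx]
    · exact (sub_pos.2 (hopt.2 _ hω.1 hx)).le
  · filter_upwards [hrange, hgrad, hYb] with ω hω hg hY
    obtain ⟨h1, h2⟩ := hY _ hω
    have hg' := abs_le.1 hg
    refine h.regret_le_of_costDeriv_le hopt hsc (optimalOrder_le_demandBound h hbdd hmin hopt) hω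
      (div_nonneg (add_nonneg hC₁ (hY0 ω)) (Real.sqrt_nonneg _)) ?_ fun hpos => ?_
    · rw [add_div]
      linarith
    · rw [add_div]
      linarith [h2 hpos]

end Regret

lemma sq_le_K₄ {C₀ B C₁ : ℝ} (hC₀ : 0 ≤ C₀) (hB : 0 ≤ B) (hC₁ : 0 ≤ C₁) :
    (4 * C₀ * B + C₁) ^ 2 ≤ K₄ C₀ B C₁ := by
  have : 0 ≤ 2 * B ^ 2 + √(2 * Real.pi) * B * (4 * C₀ * B + C₁) := by positivity
  rw [K₄]
  linarith

/-- The bound in terms of `A = 4 C₀ B + C₁` is below the stated one. -/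
lemma bound_le_K {C₀ B C₁ M α γ L : ℝ} (hC₀ : 0 ≤ C₀) (hB : 0 ≤ B) (hC₁ : 0 ≤ C₁) (hM : 0 ≤ M)
    (hα : 0 < α) (hγ : 0 < γ) (hL : 0 ≤ L) :
    M * (4 * C₀ * B + C₁) + (4 * C₀ * B + C₁) ^ 2 / α * L + 8 * M * (4 * C₀ * B + C₁) ^ 2 / γ
      ≤ K₁ C₀ B C₁ M + K₂ C₀ B C₁ M * (1 / γ) + K₃ C₀ B C₁ * (L / α) := by
  have hK := sq_le_K₄ hC₀ hB hC₁
  rw [K₁, K₂, K₃]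
  set A := 4 * C₀ * B + C₁
  have hA : 0 ≤ A := by positivity
  set κ := K₄ C₀ B C₁
  have hAK : A ≤ √κ := Real.le_sqrt_of_sq_le hK
  have hs : 1 ≤ √(2 : ℝ) := Real.one_le_sqrt.2 (by norm_num)
  have h1 : M * A ≤ 2 * M * √κ := by nlinarith
  have h2 : 8 * M * A ^ 2 / γ
      ≤ (8 * √2 * M * √κ * A + 8 * M * √κ / A) * (1 / γ) := by
    rw [div_eq_mul_one_div]
    gcongr
    have e1 : 8 * M * A ^ 2 ≤ 8 * √2 * M * √κ * A :=
      calc 8 * M * A ^ 2 = 8 * 1 * M * A * A := by ring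
        _ ≤ 8 * √2 * M * √κ * A := by gcongr
    have e2 : 0 ≤ 8 * M * √κ / A := by positivity
    linarith
  have h3 : A ^ 2 / α * L ≤ 2 * κ * (L / α) := by
    rw [div_mul_eq_mul_div, ← mul_div_assoc]
    gcongr
    linarith [sq_nonneg A]
  linarith

end Newsvendor

theorem theorem1 :
    ∃ C₀ : ℝ, 0 < C₀ ∧
      ∀ (Ω : Type*) [MeasurableSpace Ω] (P : Measure Ω) [IsProbabilityMeasure P]
        -- the demand law, and the i.i.d. nonnegative demands
        (ν : Measure ℝ) [IsProbabilityMeasure ν] (D : ℕ → Ω → ℝ)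
        (_ : ∀ᵐ d ∂ν, 0 ≤ d)
        (_ : ∀ i, HasLaw (D i) ν P)
        (_ : iIndepFun D P)
        -- the cost function: convex, with a twice differentiable expectation
        (c c' : ℝ → ℝ → ℝ)
        (_ : ∀ d, 0 ≤ d → ConvexOn ℝ (Ici 0) (fun x => c x d))
        (_ : ∀ x, 0 ≤ x → Integrable (c x) ν)
        (_ : Newsvendor.TwiceDifferentiableCost c ν)
        (_ : Newsvendor.IsSubgradientFunction c c')
        -- bounded demand
        (_ : BddAbove (Newsvendor.demandSet ν))
        -- each `c(·, d)` is minimized at some `x_d ≤ d`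
        (_ : ∀ d, 0 ≤ d → ∃ x, 0 ≤ x ∧ x ≤ d ∧ ∀ y, 0 ≤ y → c x d ≤ c y d)
        -- bounded subgradients
        (B C₁ : ℝ) (_ : 0 ≤ B) (_ : 0 ≤ C₁)
        (_ : ∀ d, 0 ≤ d → ∀ x, 0 ≤ x → |c' x d| ≤ B)
        -- the SAA decisions over the horizon `T`
        (T : ℕ) (_ : 1 ≤ T) (xhat : ℕ → Ω → ℝ)
        (_ : ∀ t ∈ Finset.Icc 1 T, AEMeasurable (xhat t) P)
        (_ : ∀ t ∈ Finset.Icc 1 T, ∀ᵐ ω ∂P,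
          Newsvendor.IsSAAOrder c (Newsvendor.demandBound ν) t (fun i => D i ω) (xhat t ω))
        (_ : ∀ t ∈ Finset.Icc 1 T, ∀ᵐ ω ∂P,
          |Newsvendor.empiricalGradient c' t (fun i => D i ω) (xhat t ω)| ≤ C₁ / √(t : ℝ))
        -- local strong convexity around the optimal order
        (xstar α β : ℝ)
        (_ : Newsvendor.IsOptimalOrder c ν xstar)
        (_ : Newsvendor.LocallyStronglyConvex c ν xstar α β),
        (∀ t ∈ Finset.Icc 1 T, Integrable
          (fun ω => Newsvendor.expectedCost c ν (xhat t ω) - Newsvendor.expectedCost c ν xstar) P) ∧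
        ∑ t ∈ Finset.Icc 1 T,
            ∫ ω, (Newsvendor.expectedCost c ν (xhat t ω) - Newsvendor.expectedCost c ν xstar) ∂P
          ≤ Newsvendor.K₁ C₀ B C₁ (Newsvendor.demandBound ν)
            + Newsvendor.K₂ C₀ B C₁ (Newsvendor.demandBound ν) * (1 / (α * β))
            + Newsvendor.K₃ C₀ B C₁ * (Real.log T / α) := by
  -- Chosen so that 4C₀B = 100B, the constant of the uniform gradient error.
  refine ⟨25, by norm_num, ?_⟩
  intro Ω _ P _ ν _ D hnn hD hind c c' hconv hint hdiff hsub hbdd hmin B C₁ hB hC₁ hb T hT xhat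
    hxm hsaa hgrad xstar α β hopt hsc
  have h : Newsvendor.IsRegularCost c c' ν B := ⟨hnn, hconv, hint, hdiff, hsub, hb⟩
  have hBpos := h.bound_pos hopt
  have hM := Newsvendor.demandBound_nonneg hnn hbdd
  have key := fun t (ht : t ∈ Finset.Icc 1 T) => h.integral_regret_le hD hind hbdd hmin hC₁
    (Finset.mem_Icc.1 ht).1 (hxm t ht) (hsaa t ht) (hgrad t ht) hopt hsc
  refine ⟨fun t ht => (key t ht).1, ?_⟩
  have hγ := mul_pos hsc.1 hsc.2.1
  refine (Newsvendor.sum_regret_le (A := C₁ + 100 * B) (by positivity) hM hsc.1 hγ hT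
    (fun t ht => (key t ht).2.1) (fun t ht => (key t ht).2.2)).trans ?_
  have hA : C₁ + 100 * B = 4 * 25 * B + C₁ := by ring
  rw [hA]
  exact Newsvendor.bound_le_K (by norm_num) hB hC₁ hM hsc.1 hγ
    (Real.log_nonneg (by exact_mod_cast hT))
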